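/- **Setting.** Let $T$ be a finite strongly binary rooted tree (each node has zero or two children) with node set $V$, root $r$, leaf set $L$ (the items) and height $h$ (number of edges of a longest root-to-leaf path). For $i\in V$ let $T(i)$ be the subtree rooted at $i$ and $L(i)$ its set of leaves. A *cut* $c$ splits $V$ into the nodes above $c$, an ancestor-closed set $\mathcal{AB}(c)$ of internal nodes, and the nodes below $c$; its lower boundary $\mathcal{LB}(c)$ consists of the nodes below $c$ whose parent is above $c$ (and is $\{r\}$ if $\mathcal{AB}(c)=\emptyset$; then the cut edge is the one joining $r$ to a dummy parent). The cut induces the clustering $\mathcal C(c)=\{L(i): i\in\mathcal{LB}(c)\}$ of $L$. Let $T'_c$ be the subtree of $T$ with node set $(\mathcal{AB}(c)\cup\mathcal{LB}(c))\setminus L$ and let $\widetilde K(T,c)$ be its number of leaves. A *prior* over cuts is given by numbers $\Pr(i)\in[0,1]$, $i\in V$, with $\Pr(i)=1$ for $i\in L$, through $\Pr(c)=\prod_{i\in\mathcal{AB}(c)}(1-\Pr(i))\prod_{j\in\mathcal{LB}(c)}\Pr(j)$. In the *noiseless realizable setting* the learner knows $T$ and the prior, and may query, for pairs of items, whether they belong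 to the same cluster of $\mathcal C(c^*)$ (answer $1$) or not (answer $-1$), where $c^*$ is an unknown cut. The label $y(i)$ of an internal node $i$ ($1$ if $i$ is below $c^*$, $0$ if it is above) is obtained with one query, on any pair made of a leaf below the left child and a leaf below the right child of $i$. **Weighted Dichotomic Path (WDP).** The algorithm maintains a forest $F$ of subtrees of $T$ (initially $F=\{T\}$), a list of clusters (initially empty), and current values $\Pr(i)$, with $q(i)=\Pr(i)\prod_{j}(1-\Pr(j))$, the product being over the proper ancestors $j$ of $i$. While $F\neq\emptyset$: 1. Among all bottom-up paths $\pi$ from a leaf of a tree $T'\in F$ to the root $r'$ of the same tree $T'$, it selects one of maximum entropy $-\sum_{i\in\pi}q(i)\log_2 q(i)$. 2. It performs a binary search on this path. While the current path $i_0,\dots,i_m$ (from bottom to top) has $m\ge 1$, it takes $k\in\{0,\dots,m-1\}$ minimizing $\bigl|\tfrac12\sum_{j=0}^{m}q(i_j)-\sum_{j=0}^{k}q(i_j)\bigr|$ and queries $y(i_{k+1})$; the path becomes $i_{k+1},\dots,i_m$ if $y(i_{k+1})=1$, and $i_0,\dots,i_k$ if $y(i_{k+1})=0$. Let $u$ be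 the node that remains. 3. It adds the cluster $L(u)$, sets $\Pr(i)=1$ for $u$ and its descendants and $\Pr(i)=0$ for the proper ancestors of $u$, and removes $T'$ from $F$. For each sibling $s$ of a node other than $r'$ on the path from $u$ to $r'$, it adds the cluster $\{s\}$ if $s\in L$, and otherwise adds $T(s)$ to $F$. The output is the set of clusters. Ties, and the pairs of items used to query a label, are chosen arbitrarily on the basis of the queries made and answers received so far. **Theorem.** There is a universal constant $C>0$ such that the following holds for every tree $T$, every prior with $\Pr(c)>0$ for all cuts $c$ of $T$, and all ways of making the arbitrary choices in WDP. For every cut $c^*$ of $T$, WDP run on $c^*$ in the noiseless realizable setting terminates and outputs $\mathcal C(c^*)$, that is, it recovers $c^*$. Moreover, if $T$ has height $h\ge 2$, then the expected number of queries made by WDP satisfies $$\mathbb E[\#\text{queries}]\;\le\; C\;\mathbb E\bigl[\widetilde K(T,c^*)\bigr]\,\log_2 h ,$$ both expectations being over $c^*\sim\Pr(\cdot)$. -/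

import Mathlib

open scoped BigOperators

noncomputable section

namespace WDP

/-! ### Strongly binary trees, cuts, clusterings -/

/-- A node of a binary tree is addressed by the list of turns leading to it, the most recent turn
first. So `[]` is the root, `false :: i` and `true :: i` are the left and the right child of `i`,
`i.tail` is the parent of a non-root node `i`, and `j` is an ancestor of `i` (or `i` itself) iff
`j` is a suffix of `i`, written `j <:+ i`. -/
abbrev Node := List Bool

/-- The other child of the parent of a non-root node. -/
def sibling : Node → Node
  | [] => []
  | b :: i => (!b) :: i

/-- The bottom-up path from `i` to its ancestor `j`, listed from bottom to top. -/
def path (i j : Node) : List Node := i.tails.filter fun k => j <:+ k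

/-- A finite strongly binary rooted tree: every node has either no child or two children. -/
structure BinTree where
  nodes : Finset Node
  root_mem : [] ∈ nodes
  parent_mem : ∀ (b : Bool) (i : Node), b :: i ∈ nodes → i ∈ nodes
  sibling_mem : ∀ (b : Bool) (i : Node), b :: i ∈ nodes → (!b) :: i ∈ nodes

namespace BinTree

variable (T : BinTree)

/-- The leaves of the tree; these are the items to be clustered. -/
def leaves : Finset Node := T.nodes.filter fun i => ∀ b : Bool, b :: i ∉ T.nodes

/-- The internal nodes. -/
def internal : Finset Node := T.nodes \ T.leaves

/-- The height of the tree: the number of edges of a longest path from the root to a leaf. -/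
def height : ℕ := T.nodes.sup List.length

/-- `L(i)`: the leaves of the subtree rooted at `i`. -/
def leavesBelow (i : Node) : Finset Node := T.leaves.filter fun x => i <:+ x

/-- The cuts of the tree. A cut is represented by the set of the nodes above it, that is, by an
arbitrary set of internal nodes that contains the parent of each of its members. The edges of the
cut are those joining a node of `lowerBoundary` to its parent (for the cut with nothing above it:
the edge joining the root to a dummy parent). -/
def cuts : Finset (Finset Node) := T.internal.powerset.filter fun c => ∀ i ∈ c, i.tail ∈ c

/-- The lower boundary of the cut: the topmost nodes below it. -/
def lowerBoundary (c : Finset Node) : Finset Node :=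
  T.nodes.filter fun i => i ∉ c ∧ (i = [] ∨ i.tail ∈ c)

/-- The clustering of the leaves induced by a cut. -/
def clustering (c : Finset Node) : Finset (Finset Node) :=
  (T.lowerBoundary c).image T.leavesBelow

/-- The noiseless ground-truth similarity matrix of a cut: `1` for two leaves in the same cluster,
`-1` for two leaves in different clusters. -/
def similarity (c : Finset Node) (x y : Node) : ℤ :=
  if ∃ C ∈ T.clustering c, x ∈ C ∧ y ∈ C then 1 else -1

/-- The nodes of the subtree `T'_c`: those above the cut or on its lower boundary, except for the
leaves of the tree. -/
def core (c : Finset Node) : Finset Node := (c ∪ T.lowerBoundary c) \ T.leaves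

/-- `K̃(T, c)`: the number of leaves of `T'_c`. -/
def kTilde (c : Finset Node) : ℕ :=
  ((T.core c).filter fun i => ∀ b : Bool, b :: i ∉ T.core c).card

/-! ### Priors -/

/-- Parameters of a prior over cuts: `p i` is the conditional probability that `i` is below the
cut given that all its proper ancestors are above. It is `1` at the leaves. -/
structure IsPrior (p : Node → ℝ) : Prop where
  nonneg : ∀ i ∈ T.nodes, 0 ≤ p i
  le_one : ∀ i ∈ T.nodes, p i ≤ 1
  leaf : ∀ i ∈ T.leaves, p i = 1

/-- The probability of a cut. -/
def cutProb (p : Node → ℝ) (c : Finset Node) : ℝ :=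
  (∏ i ∈ c, (1 - p i)) * ∏ j ∈ T.lowerBoundary c, p j

/-- The expectation over the random cut. -/
def expect (p : Node → ℝ) (f : Finset Node → ℝ) : ℝ := ∑ c ∈ T.cuts, T.cutProb p c * f c

end BinTree

/-- `q(i)`: the probability that the edge from `i` to its parent belongs to the cut. The product
is over the proper ancestors of `i`. -/
def edgeProb (p : Node → ℝ) (i : Node) : ℝ := p i * (i.tails.tail.map fun j => 1 - p j).prod

/-- The entropy of a path. -/
def pathEntropy (p : Node → ℝ) (π : List Node) : ℝ :=
  -(π.map fun i => edgeProb p i * Real.logb 2 (edgeProb p i)).sum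

/-! ### The algorithm -/

/-- The elements of a finite set at which a function is maximal. -/
def maximizers {α : Type} (s : Finset α) (f : α → ℝ) : Finset α :=
  @Finset.filter α (fun a => ∀ b ∈ s, f b ≤ f a) (Classical.decPred _) s

theorem mem_maximizers {α : Type} {s : Finset α} {f : α → ℝ} {a : α} :
    a ∈ maximizers s f ↔ a ∈ s ∧ ∀ b ∈ s, f b ≤ f a := by
  unfold maximizers
  exact @Finset.mem_filter α _ (Classical.decPred _) s a

theorem maximizers_nonempty {α : Type} {s : Finset α} (hs : s.Nonempty) (f : α → ℝ) :
    (maximizers s f).Nonempty := by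
  obtain ⟨a, ha, hmax⟩ := Finset.exists_max_image s f hs
  exact ⟨a, mem_maximizers.2 ⟨ha, hmax⟩⟩

/-- The queries made so far, each with its two items and its answer, the most recent one first. -/
abbrev History := List (Node × Node × ℤ)

/-- A rule selecting a member of a nonempty finite set, which may use all past queries. -/
structure Selector (α : Type) where
  pick : History → Finset α → α
  pick_mem : ∀ (H : History) (s : Finset α), s.Nonempty → pick H s ∈ s

/-- The choices that the algorithm leaves open: which path of maximum entropy to search (a path is
given by its bottom and its top node), at which best splitting index to split, and which pair of
items to query in order to learn the label of a node. -/
structure Choices where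
  path : Selector (Node × Node)
  split : Selector ℕ
  pair : Selector (Node × Node)

/-- The deviation `|Q/2 - (q(i_0) + ... + q(i_k))|` of the `k`-th split of the path `i_0, ..., i_m`
from the perfect one, where `Q = q(i_0) + ... + q(i_m)`. -/
def deviation (q : Node → ℝ) (π : List Node) (k : ℕ) : ℝ :=
  |(π.map q).sum / 2 - ((π.take (k + 1)).map q).sum|

/-- The indices `k` in `{0, ..., m - 1}` of least deviation on the path `i_0, ..., i_m`. -/
def bestSplits (q : Node → ℝ) (π : List Node) : Finset ℕ :=
  maximizers (Finset.range (π.length - 1)) fun k => -deviation q π k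

/-- The selected splitting index on a path. -/
def splitIndex (ch : Choices) (q : Node → ℝ) (π : List Node) (H : History) : ℕ :=
  ch.split.pick H (bestSplits q π)

theorem splitIndex_lt (ch : Choices) (q : Node → ℝ) (π : List Node) (H : History)
    (h : 2 ≤ π.length) : splitIndex ch q π H + 1 < π.length := by
  have hm := ch.split.pick_mem H _ (maximizers_nonempty (s := Finset.range (π.length - 1))
    ⟨0, Finset.mem_range.2 (by omega)⟩ fun k => -deviation q π k)
  have hr : splitIndex ch q π H < π.length - 1 := Finset.mem_range.1 (mem_maximizers.1 hm).1
  omega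

/-- The pairs of items that reveal the label of an internal node `i`: one item below the left
child, one below the right child. -/
def BinTree.queryPairs (T : BinTree) (i : Node) : Finset (Node × Node) :=
  T.leavesBelow (false :: i) ×ˢ T.leavesBelow (true :: i)

/-- The binary search on the path `i_0, ..., i_m` (bottom to top). While the path has two nodes or
more, it queries the label of `i_(k+1)`, with `k` the splitting index. On answer `1` (that is,
`i_(k+1)` is below the cut) it continues on `i_(k+1), ..., i_m`, otherwise on `i_0, ..., i_k`. It
returns the remaining node, together with the updated history. -/
def binarySearch (T : BinTree) (ch : Choices) (σ : Node → Node → ℤ) (q : Node → ℝ)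
    (π : List Node) (H : History) : Node × History :=
  if h : 2 ≤ π.length then
    let k := splitIndex ch q π H
    let xy := ch.pair.pick H (T.queryPairs (π.getD (k + 1) []))
    let a := σ xy.1 xy.2
    let H' : History := (xy.1, xy.2, a) :: H
    if a = 1 then binarySearch T ch σ q (π.drop (k + 1)) H'
    else binarySearch T ch σ q (π.take (k + 1)) H'
  else (π.headD [], H)
termination_by π.length
decreasing_by
  · simp only [List.length_drop]; omega
  · have := splitIndex_lt ch q π H h
    simp only [List.length_take]; omega

/-- The state between two binary searches: the clusters found so far, the forest `F` (each
subtree is represented by its root), the current parameters of the (posterior) distribution, and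
the queries made so far. -/
structure State where
  clusters : Finset (Finset Node)
  forest : Finset Node
  p : Node → ℝ
  history : History

/-- The initial state: the forest consists of the whole tree. -/
def initState (p : Node → ℝ) : State := ⟨∅, {[]}, p, []⟩

/-- The bottom-up paths from a leaf of a subtree in the forest to the root of that subtree. -/
def BinTree.forestPaths (T : BinTree) (F : Finset Node) : Finset (Node × Node) :=
  (T.leaves ×ˢ F).filter fun e => e.2 <:+ e.1

/-- Those among them that have maximum entropy. -/
def BinTree.maxEntropyPaths (T : BinTree) (p : Node → ℝ) (F : Finset Node) :
    Finset (Node × Node) :=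
  maximizers (T.forestPaths F) fun e => pathEntropy p (path e.1 e.2)

/-- The posterior parameters once the edge from `u` to its parent is known to be in the cut: `1`
at `u` and its descendants, `0` at the proper ancestors of `u`, unchanged elsewhere. -/
def posterior (p : Node → ℝ) (u i : Node) : ℝ :=
  if u <:+ i then 1 else if i <:+ u then 0 else p i

/-- The siblings of the nodes on the path from `u` to `r` other than `r`. -/
def hanging (u r : Node) : Finset Node :=
  (((path u r).filter fun i => i ≠ r).map sibling).toFinset

/-- One pass of the main loop: select a path from `e.1` up to `e.2` of maximum entropy, search it
for the node `u` whose parent edge is cut, record the cluster `L(u)` and the singleton clusters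
hanging off the path above `u`, replace the subtree searched by the non-trivial subtrees hanging
off the path above `u`, and update the distribution. -/
def round (T : BinTree) (ch : Choices) (σ : Node → Node → ℤ) (s : State) : State :=
  let e := ch.path.pick s.history (T.maxEntropyPaths s.p s.forest)
  let res := binarySearch T ch σ (edgeProb s.p) (path e.1 e.2) s.history
  let u := res.1
  { clusters := insert (T.leavesBelow u) s.clusters ∪
      ((hanging u e.2).filter fun i => i ∈ T.leaves).image fun x => {x}
    forest := s.forest.erase e.2 ∪ (hanging u e.2).filter fun i => i ∉ T.leaves
    p := posterior s.p u
    history := res.2 }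

/-- `Run T ch σ s s'`: the loop "while the forest is nonempty, do a round", started in state `s`
and with the similarity matrix `σ` answering the queries, terminates in state `s'`. -/
inductive Run (T : BinTree) (ch : Choices) (σ : Node → Node → ℤ) : State → State → Prop
  | done (s : State) : s.forest = ∅ → Run T ch σ s s
  | step (s s' : State) : s.forest ≠ ∅ → Run T ch σ (round T ch σ s) s' → Run T ch σ s s'

end WDP

end

/-! ### Paths, cuts and queries in the tree -/

namespace WDP

/-! The expected cost is bounded by (number of rounds) × (expected cost of a round): each round is
charged to a leaf of `T'_c`, and it costs at most `log₂(h+1) + 2` on average.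

Number of rounds. Let a round search the path from a leaf `x` to a root `r` and find `u`. A path of
maximum entropy must have a leaf as the sibling of its bottom leaf: otherwise the weight of `x`
could be replaced by the same total weight split over several nodes below that sibling, which
strictly raises the entropy (`pathEntropy_lt`, `Inv.sibling_leaf`). This is the only use of
maximality. Hence `u` is a leaf of `T'_c`, or is an item whose parent has two items as children and
is therefore a leaf of `T'_c` (`exists_coreLeaf`). That leaf lies between `r` and `u`, so it leaves
the forest in this round (`Inv.under_nextState_lt`), and no other round is charged to it.

Cost of a round. Under the posterior the weights `q` along the path telescope to 1
(`Inv.sum_edgeProb`). For a segment of `n` nodes with total weight `Q`, the `q`-weighted number of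
queries is at most `Q log₂ n + 2Q` minus the weights of its two end nodes (`binarySearch_spec`).
Subtracting the end weights makes the induction close: a best split is unbalanced by at most the
weights of the two nodes next to it, and these become ends of the two halves.

The two bounds combine by induction on the forest. Conditioning on "the edge above `u` is cut" gives
a law of the same product form, with parameters `posterior` (`BinTree.cutProb_eq_mul_posterior`).
Inside the remaining trees the parameters do not change, so the invariant `Inv` persists. Averaging
over `u` gives `Inv.exists_final`, where the expected cost of the round is paid for by the loss of
one leaf of `T'_c`. Correctness comes from the same invariant: the clusters of the cut are those
recorded and those of boundary nodes still inside the forest. -/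

theorem mem_path {i j k : Node} : k ∈ path i j ↔ k <:+ i ∧ j <:+ k := by
  simp [path, List.mem_filter, List.mem_tails]

theorem path_cons {b : Bool} {i j : Node} (h : j <:+ i) :
    path (b :: i) j = (b :: i) :: path i j := by
  have : j <:+ b :: i := h.trans (List.suffix_cons b i)
  simp [path, List.tails, this]

theorem path_self (i : Node) : path i i = [i] := by
  cases i with
  | nil => simp [path]
  | cons b t =>
    have h : ∀ k ∈ t.tails, ¬ (b :: t) <:+ k := by
      intro k hk hs
      have h1 := ((List.mem_tails _ _).1 hk).length_le
      have h2 := hs.length_le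
      simp at h2
      omega
    simp only [path, List.tails, List.filter_cons, List.suffix_refl, decide_true, if_true]
    rw [List.filter_eq_nil_iff.2]
    simpa using h

theorem suffix_cases {i j : Node} (h : j <:+ i) : j = i ∨ (i ≠ [] ∧ j <:+ i.tail) := by
  cases i with
  | nil => left; simpa using h
  | cons b t => rcases List.suffix_cons_iff.1 h with h | h
                · exact Or.inl h
                · exact Or.inr ⟨by simp, h⟩

theorem suffix_tail {i j : Node} (h : j <:+ i) (hne : j ≠ i) : j <:+ i.tail :=
  ((suffix_cases h).resolve_left hne).2

theorem suffix_antisymm {i j : Node} (h : i <:+ j) (h' : j <:+ i) : i = j :=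
  h.eq_of_length (le_antisymm h.length_le h'.length_le)

theorem suffix_total {i j k : Node} (h : i <:+ k) (h' : j <:+ k) : i <:+ j ∨ j <:+ i :=
  List.suffix_or_suffix_of_suffix h h'

/-- Decomposition of a path at a node of it. -/
theorem path_append {x s : Node} (h : s <:+ x) {a r : Node} {b : Bool} (hs : s = b :: a)
    (hr : r <:+ a) : path x r = path x s ++ path a r := by
  subst hs
  induction x with
  | nil => simp at h
  | cons d t ih =>
    rcases suffix_cases h with h | ⟨-, h⟩
    · obtain ⟨rfl, rfl⟩ := List.cons.inj h
      rw [path_self, path_cons hr]; rfl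
    · rw [List.tail_cons] at h
      rw [path_cons h, path_cons ((hr.trans (List.suffix_cons b a)).trans h), ih h]; rfl

theorem path_pairwise (x r : Node) : (path x r).Pairwise fun i j => j <:+ i ∧ j ≠ i := by
  unfold path
  apply List.Pairwise.filter
  induction x with
  | nil => simp
  | cons b t ih =>
    rw [List.tails, List.pairwise_cons]
    refine ⟨fun k hk => ?_, ih⟩
    have hk := (List.mem_tails _ _).1 hk
    refine ⟨hk.trans (List.suffix_cons b t), fun h => ?_⟩
    have := hk.length_le
    rw [h] at this
    simp at this

theorem path_ne_nil {x r : Node} (h : r <:+ x) : path x r ≠ [] :=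
  List.ne_nil_of_mem (mem_path.2 ⟨List.suffix_refl x, h⟩)

theorem path_length_le (x r : Node) : (path x r).length ≤ x.length + 1 := by
  unfold path
  exact (List.length_filter_le _ _).trans (by simp)

namespace BinTree

variable {T : BinTree}

theorem mem_of_suffix {i j : Node} (h : j <:+ i) (hi : i ∈ T.nodes) : j ∈ T.nodes := by
  induction i with
  | nil => rw [List.suffix_nil.1 h]; exact hi
  | cons b t ih =>
    rcases suffix_cases h with rfl | ⟨-, h⟩
    · exact hi
    · exact ih h (T.parent_mem b t hi)

theorem mem_leaves {i : Node} : i ∈ T.leaves ↔ i ∈ T.nodes ∧ ∀ b : Bool, b :: i ∉ T.nodes := by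
  simp [leaves]

theorem mem_internal {i : Node} : i ∈ T.internal ↔ i ∈ T.nodes ∧ i ∉ T.leaves := by
  simp [internal]

theorem child_mem {i : Node} (h : i ∈ T.internal) (b : Bool) : b :: i ∈ T.nodes := by
  obtain ⟨h1, h2⟩ := mem_internal.1 h
  rw [mem_leaves] at h2
  push Not at h2
  obtain ⟨d, hd⟩ := h2 h1
  rcases Bool.eq_or_eq_not b d with rfl | rfl
  · exact hd
  · exact T.sibling_mem _ _ hd

theorem internal_of_child {b : Bool} {i : Node} (h : b :: i ∈ T.nodes) : i ∈ T.internal :=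
  mem_internal.2 ⟨T.parent_mem b i h, fun hl => (mem_leaves.1 hl).2 b h⟩

theorem internal_of_proper {i j : Node} (h : j <:+ i) (hne : j ≠ i) (hi : i ∈ T.nodes) :
    j ∈ T.internal := by
  cases i with
  | nil => exact absurd (List.suffix_nil.1 h) hne
  | cons b t =>
    have h : j <:+ t := suffix_tail h hne
    by_cases hj : j = t
    · exact hj ▸ internal_of_child hi
    · exact internal_of_proper h hj (T.parent_mem b t hi)

theorem eq_of_leaf_suffix {i j : Node} (hj : j ∈ T.leaves) (h : j <:+ i) (hi : i ∈ T.nodes) :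
    j = i := by
  by_contra hne
  exact (mem_internal.1 (internal_of_proper h hne hi)).2 hj

theorem exists_leaf_below {i : Node} (hi : i ∈ T.nodes) : ∃ x ∈ T.leaves, i <:+ x := by
  obtain ⟨x, hx, hmax⟩ := Finset.exists_max_image (T.nodes.filter fun x => i <:+ x) List.length
    ⟨i, by simp [hi]⟩
  rw [Finset.mem_filter] at hx
  refine ⟨x, mem_leaves.2 ⟨hx.1, fun b hb => ?_⟩, hx.2⟩
  have := hmax (b :: x) (by simp only [Finset.mem_filter]
                            exact ⟨hb, hx.2.trans (List.suffix_cons b x)⟩)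
  simp at this

theorem mem_leavesBelow {i x : Node} : x ∈ T.leavesBelow i ↔ x ∈ T.leaves ∧ i <:+ x := by
  simp [leavesBelow]

theorem leavesBelow_leaf {i : Node} (hi : i ∈ T.leaves) : T.leavesBelow i = {i} := by
  ext x
  rw [mem_leavesBelow, Finset.mem_singleton]
  constructor
  · rintro ⟨hx, h⟩
    exact (eq_of_leaf_suffix hi h (mem_leaves.1 hx).1).symm
  · rintro rfl
    exact ⟨hi, List.suffix_refl _⟩

theorem mem_cuts {c : Finset Node} :
    c ∈ T.cuts ↔ c ⊆ T.internal ∧ ∀ i ∈ c, i.tail ∈ c := by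
  simp [cuts]

theorem mem_lowerBoundary {c : Finset Node} {i : Node} :
    i ∈ T.lowerBoundary c ↔ i ∈ T.nodes ∧ i ∉ c ∧ (i = [] ∨ i.tail ∈ c) := by
  simp [lowerBoundary]

theorem cut_of_suffix {c : Finset Node} (hc : c ∈ T.cuts) {i j : Node} (h : j <:+ i)
    (hi : i ∈ c) : j ∈ c := by
  induction i with
  | nil => rw [List.suffix_nil.1 h]; exact hi
  | cons b t ih =>
    rcases suffix_cases h with rfl | ⟨-, h⟩
    · exact hi
    · exact ih h ((mem_cuts.1 hc).2 _ hi)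

theorem above_of_proper {c : Finset Node} (hc : c ∈ T.cuts) {u i : Node}
    (hu : u ∈ T.lowerBoundary c) (h : i <:+ u) (hne : i ≠ u) : i ∈ c := by
  obtain ⟨h0, h1⟩ := (suffix_cases h).resolve_left hne
  exact cut_of_suffix hc h1 ((mem_lowerBoundary.1 hu).2.2.resolve_left h0)

theorem below_of_suffix {c : Finset Node} (hc : c ∈ T.cuts) {u i : Node}
    (hu : u ∈ T.lowerBoundary c) (h : u <:+ i) : i ∉ c :=
  fun hi => (mem_lowerBoundary.1 hu).2.1 (cut_of_suffix hc h hi)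

theorem lowerBoundary_antichain {c : Finset Node} (hc : c ∈ T.cuts) {u v : Node}
    (hu : u ∈ T.lowerBoundary c) (hv : v ∈ T.lowerBoundary c) (h : u <:+ v) : u = v := by
  by_contra hne
  exact (mem_lowerBoundary.1 hu).2.1 (above_of_proper hc hv h hne)

/-- Climb from `i` towards the root and stop just before entering `c`, or at the root. -/
theorem exists_lowerBoundary {c : Finset Node} {i : Node} (hi : i ∈ T.nodes) (hic : i ∉ c) :
    ∃ u ∈ T.lowerBoundary c, u <:+ i := by
  induction i with
  | nil => exact ⟨[], mem_lowerBoundary.2 ⟨hi, hic, Or.inl rfl⟩, List.suffix_refl _⟩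
  | cons b t ih =>
    by_cases ht : t ∈ c
    · exact ⟨b :: t, mem_lowerBoundary.2 ⟨hi, hic, Or.inr ht⟩, List.suffix_refl _⟩
    · obtain ⟨u, hu, h⟩ := ih (T.parent_mem b t hi) ht
      exact ⟨u, hu, h.trans (List.suffix_cons b t)⟩

theorem leaf_not_mem_cut {c : Finset Node} (hc : c ∈ T.cuts) {i : Node} (hi : i ∈ T.leaves) :
    i ∉ c := fun h => (mem_internal.1 ((mem_cuts.1 hc).1 h)).2 hi

/-- A common ancestor of leaves below different children of `i` is an ancestor of `i`. -/
theorem suffix_of_suffix_both {i j x y : Node} (hx : false :: i <:+ x) (hy : true :: i <:+ y)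
    (hjx : j <:+ x) (hjy : j <:+ y) : j <:+ i := by
  rcases suffix_total hjx hx with h | h
  · rcases suffix_cases h with rfl | ⟨-, h⟩
    · rcases suffix_total hjy hy with h' | h'
      · have := h'.eq_of_length (by simp)
        simp at this
      · have := h'.eq_of_length (by simp)
        simp at this
    · exact h
  · exfalso
    rcases suffix_total (h.trans hjy) hy with h' | h'
    · have := h'.eq_of_length (by simp)
      simp at this
    · have := h'.eq_of_length (by simp)
      simp at this

/-- A query for an internal node reveals its label. -/
theorem similarity_queryPairs {c : Finset Node} (hc : c ∈ T.cuts) {i : Node} {e : Node × Node}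
    (he : e ∈ T.queryPairs i) (hi : i ∈ T.nodes) : T.similarity c e.1 e.2 = 1 ↔ i ∉ c := by
  rw [queryPairs, Finset.mem_product, mem_leavesBelow, mem_leavesBelow] at he
  obtain ⟨⟨hx, hix⟩, hy, hiy⟩ := he
  have key : (∃ C ∈ T.clustering c, e.1 ∈ C ∧ e.2 ∈ C) ↔ i ∉ c := by
    constructor
    · rintro ⟨C, hC, h1, h2⟩
      obtain ⟨j, hj, rfl⟩ := Finset.mem_image.1 hC
      exact below_of_suffix hc hj (suffix_of_suffix_both hix hiy (mem_leavesBelow.1 h1).2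
        (mem_leavesBelow.1 h2).2)
    · intro h
      obtain ⟨u, hu, hui⟩ := exists_lowerBoundary hi h
      exact ⟨_, Finset.mem_image_of_mem _ hu,
        mem_leavesBelow.2 ⟨hx, (hui.trans (List.suffix_cons _ _)).trans hix⟩,
        mem_leavesBelow.2 ⟨hy, (hui.trans (List.suffix_cons _ _)).trans hiy⟩⟩
  rw [similarity]
  split_ifs with h
  · simpa using key.1 h
  · simpa using fun h' => h (key.2 h')

theorem queryPairs_nonempty {i : Node} (hi : i ∈ T.internal) : (T.queryPairs i).Nonempty := by
  obtain ⟨x, hx, h⟩ := exists_leaf_below (child_mem hi false)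
  obtain ⟨y, hy, h'⟩ := exists_leaf_below (child_mem hi true)
  exact ⟨(x, y), Finset.mem_product.2 ⟨mem_leavesBelow.2 ⟨hx, h⟩, mem_leavesBelow.2 ⟨hy, h'⟩⟩⟩

end BinTree

end WDP

/-! ### Edge probabilities and the entropy of a path -/

noncomputable section

namespace WDP

/-- The probability that all proper ancestors of a node are above the cut. -/
def aboveProb (p : Node → ℝ) (i : Node) : ℝ := (i.tails.tail.map fun j => 1 - p j).prod

theorem edgeProb_eq (p : Node → ℝ) (i : Node) : edgeProb p i = p i * aboveProb p i := rfl

theorem aboveProb_cons (p : Node → ℝ) (b : Bool) (i : Node) :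
    aboveProb p (b :: i) = (1 - p i) * aboveProb p i := by
  cases i <;> simp [aboveProb]

theorem mem_tails_tail {i k : Node} : k ∈ i.tails.tail ↔ k <:+ i ∧ k ≠ i := by
  cases i with
  | nil => simp
  | cons b t =>
    rw [List.tails, List.tail_cons, List.mem_tails]
    constructor
    · intro h
      refine ⟨h.trans (List.suffix_cons b t), ?_⟩
      rintro rfl
      have := h.length_le
      simp at this
    · rintro ⟨h, hne⟩
      exact suffix_tail h hne

theorem tails_nodup (i : Node) : i.tails.Nodup := by
  have h := path_pairwise i []
  have : path i [] = i.tails := by simp [path]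
  rw [this] at h
  exact h.imp fun h => h.2.symm

theorem aboveProb_eq_one {p : Node → ℝ} {i : Node} (h : ∀ k, k <:+ i → k ≠ i → p k = 0) :
    aboveProb p i = 1 := by
  apply List.prod_eq_one
  intro y hy
  obtain ⟨k, hk, rfl⟩ := List.mem_map.1 hy
  obtain ⟨h1, h2⟩ := mem_tails_tail.1 hk
  simp [h k h1 h2]

theorem aboveProb_pos {p : Node → ℝ} {i : Node} (h : ∀ k, k <:+ i → k ≠ i → p k < 1) :
    0 < aboveProb p i := by
  apply List.prod_pos
  intro y hy
  obtain ⟨k, hk, rfl⟩ := List.mem_map.1 hy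
  obtain ⟨h1, h2⟩ := mem_tails_tail.1 hk
  linarith [h k h1 h2]

theorem edgeProb_pos {p : Node → ℝ} {i : Node} (h : ∀ k, k <:+ i → k ≠ i → p k < 1)
    (h0 : 0 < p i) : 0 < edgeProb p i :=
  mul_pos h0 (aboveProb_pos h)

/-- Telescoping: `edgeProb p i` is `aboveProb p i - (1 - p i) * aboveProb p i`, and the subtracted
term is `aboveProb` at either child of `i`. -/
theorem sum_edgeProb_path (p : Node → ℝ) {x s : Node} (h : s <:+ x) :
    ((path x s).map (edgeProb p)).sum + (1 - p x) * aboveProb p x = aboveProb p s := by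
  induction x with
  | nil =>
    rw [List.suffix_nil.1 h, path_self]
    simp [edgeProb_eq]
    ring
  | cons b t ih =>
    rcases suffix_cases h with rfl | ⟨-, h⟩
    · rw [path_self]
      simp [edgeProb_eq]
      ring
    · rw [List.tail_cons] at h
      rw [path_cons h, ← ih h, List.map_cons, List.sum_cons, edgeProb_eq, aboveProb_cons]
      ring

/-- Extending a path below the sibling of its bottom leaf increases its entropy. -/
theorem pathEntropy_lt {p : Node → ℝ} {a r x : Node} {b : Bool} (hr : r <:+ a)
    (hb : p (b :: a) = 1) (hx : (!b) :: a <:+ x) (hpx : p x = 1) (hs : p ((!b) :: a) < 1)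
    (hp : ∀ k, k <:+ x → k ≠ x → p k < 1) (hp0 : ∀ k, k <:+ x → (!b) :: a <:+ k → 0 < p k) :
    pathEntropy p (path (b :: a) r) < pathEntropy p (path x r) := by
  set s : Node := (!b) :: a with hsdef
  -- Siblings have the same proper ancestors. As `p (b :: a) = 1`, the leaf `b :: a` has weight
  -- exactly `W`, which is also the total weight of the replacement path from `x` up to `s`.
  have hW : aboveProb p (b :: a) = aboveProb p s := by rw [aboveProb_cons, hsdef, aboveProb_cons]
  have hsum := sum_edgeProb_path p hx
  rw [hpx, sub_self, zero_mul, add_zero] at hsum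
  set W := aboveProb p s
  have hpos : ∀ k ∈ path x s, 0 < edgeProb p k := by
    intro k hk
    obtain ⟨h1, h2⟩ := mem_path.1 hk
    refine edgeProb_pos (fun j hj hne => ?_) (hp0 k h1 h2)
    refine hp j (hj.trans h1) ?_
    rintro rfl
    exact hne (suffix_antisymm hj h1)
  have hle : ∀ k ∈ path x s, edgeProb p k ≤ W := by
    intro k hk
    rw [← hsum]
    apply List.single_le_sum _ _ (List.mem_map_of_mem hk)
    intro y hy
    obtain ⟨j, hj, rfl⟩ := List.mem_map.1 hy
    exact (hpos j hj).le
  have hsm : s ∈ path x s := mem_path.2 ⟨hx, List.suffix_refl _⟩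
  have hWpos : 0 < W := (hpos s hsm).trans_le (hle s hsm)
  -- Every weight on the replacement path is at most `W`, and that of `s` is strictly smaller
  -- because `p s < 1`; so splitting `W` strictly lowers `∑ q log q`.
  have key : ((path x s).map fun k => edgeProb p k * Real.logb 2 (edgeProb p k)).sum <
      ((path x s).map fun k => edgeProb p k * Real.logb 2 W).sum := by
    apply List.sum_lt_sum
    · intro k hk
      exact mul_le_mul_of_nonneg_left
        (Real.logb_le_logb_of_le (by norm_num) (hpos k hk) (hle k hk)) (hpos k hk).le
    · refine ⟨s, hsm, mul_lt_mul_of_pos_left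
        (Real.logb_lt_logb (by norm_num) (hpos s hsm) ?_) (hpos s hsm)⟩
      rw [edgeProb_eq]
      nlinarith
  rw [List.sum_map_mul_right, hsum] at key
  unfold pathEntropy
  rw [path_cons hr, path_append hx hsdef hr, List.map_cons, List.sum_cons, List.map_append,
    List.sum_append, edgeProb_eq p (b :: a), hb, hW, one_mul]
  linarith

/-! ### Total mass and conditioning of the law of the cut -/

namespace BinTree

variable {T : BinTree}

theorem cutProb_nonneg {p : Node → ℝ} (hp : T.IsPrior p) {c : Finset Node} (hc : c ∈ T.cuts) :
    0 ≤ T.cutProb p c := by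
  refine mul_nonneg (Finset.prod_nonneg fun i hi => ?_) (Finset.prod_nonneg fun i hi => ?_)
  · have := hp.le_one i (mem_internal.1 ((mem_cuts.1 hc).1 hi)).1
    linarith
  · exact hp.nonneg i (mem_lowerBoundary.1 hi).1

theorem posterior_self (p : Node → ℝ) (u : Node) : posterior p u u = 1 := by
  simp [posterior]

theorem posterior_below (p : Node → ℝ) {u i : Node} (h : u <:+ i) : posterior p u i = 1 := by
  simp [posterior, h]

theorem posterior_above (p : Node → ℝ) {u i : Node} (h : i <:+ u) (hne : i ≠ u) :
    posterior p u i = 0 := by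
  have : ¬ u <:+ i := fun h' => hne (suffix_antisymm h h')
  simp [posterior, h, this]

theorem posterior_of_incomparable (p : Node → ℝ) {u i : Node} (h : ¬ u <:+ i) (h' : ¬ i <:+ u) :
    posterior p u i = p i := by
  simp [posterior, h, h']

theorem cutProb_eq_zero_of_mem {p : Node → ℝ} {c : Finset Node} {i : Node} (hi : i ∈ c)
    (h : p i = 1) : T.cutProb p c = 0 := by
  rw [cutProb, Finset.prod_eq_zero hi (by rw [h, sub_self]), zero_mul]

theorem cutProb_eq_zero_of_mem_lowerBoundary {p : Node → ℝ} {c : Finset Node} {i : Node}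
    (hi : i ∈ T.lowerBoundary c) (h : p i = 0) : T.cutProb p c = 0 := by
  rw [cutProb, Finset.prod_eq_zero hi h, mul_zero]

/-- If `u` is above the cut it contributes the factor `1 - 1`. Otherwise the boundary node above `u`
is a proper ancestor of `u`, where the posterior parameter is `0`. -/
theorem cutProb_posterior_of_not_mem {p : Node → ℝ} {c : Finset Node}
    {u : Node} (hu : u ∈ T.nodes) (h : u ∉ T.lowerBoundary c) :
    T.cutProb (posterior p u) c = 0 := by
  by_cases huc : u ∈ c
  · exact cutProb_eq_zero_of_mem huc (posterior_self p u)
  · obtain ⟨v, hv, hvu⟩ := exists_lowerBoundary hu huc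
    refine cutProb_eq_zero_of_mem_lowerBoundary hv (posterior_above p hvu ?_)
    rintro rfl
    exact h hv

/-- `posterior` describes the conditional distribution. -/
theorem cutProb_eq_mul_posterior {p : Node → ℝ} {c : Finset Node} (hc : c ∈ T.cuts)
    {u : Node} (h : u ∈ T.lowerBoundary c) :
    T.cutProb p c = edgeProb p u * T.cutProb (posterior p u) c := by
  -- The factors of `u` and of its proper ancestors multiply to `edgeProb p u`, and become `1` under
  -- the posterior. All other factors belong to nodes incomparable with `u`, where the parameters
  -- agree.
  have hA : u.tails.tail.toFinset ⊆ c := by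
    intro i hi
    obtain ⟨h1, h2⟩ := mem_tails_tail.1 (List.mem_toFinset.1 hi)
    exact above_of_proper hc h h1 h2
  have hN : u.tails.tail.Nodup := (List.tail_sublist _).nodup (tails_nodup u)
  have e1 : ∀ p : Node → ℝ, ∏ i ∈ c, (1 - p i) =
      (∏ i ∈ c \ u.tails.tail.toFinset, (1 - p i)) * aboveProb p u := by
    intro p
    rw [← Finset.prod_sdiff hA, List.prod_toFinset _ hN, aboveProb]
  have e2 : ∀ p : Node → ℝ, ∏ i ∈ T.lowerBoundary c, p i =
      p u * ∏ i ∈ (T.lowerBoundary c).erase u, p i :=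
    fun p => (Finset.mul_prod_erase _ _ h).symm
  have e3 : aboveProb (posterior p u) u = 1 :=
    aboveProb_eq_one fun k h1 h2 => posterior_above p h1 h2
  have e4 : ∏ i ∈ c \ u.tails.tail.toFinset, (1 - posterior p u i) =
      ∏ i ∈ c \ u.tails.tail.toFinset, (1 - p i) := by
    refine Finset.prod_congr rfl fun i hi => ?_
    rw [Finset.mem_sdiff, List.mem_toFinset, mem_tails_tail] at hi
    rw [posterior_of_incomparable]
    · exact fun h' => below_of_suffix hc h h' hi.1
    · intro h'
      refine hi.2 ⟨h', ?_⟩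
      rintro rfl
      exact (mem_lowerBoundary.1 h).2.1 hi.1
  have e5 : ∏ i ∈ (T.lowerBoundary c).erase u, posterior p u i =
      ∏ i ∈ (T.lowerBoundary c).erase u, p i := by
    refine Finset.prod_congr rfl fun i hi => ?_
    obtain ⟨h1, h2⟩ := Finset.mem_erase.1 hi
    rw [posterior_of_incomparable]
    · exact fun h' => h1 (lowerBoundary_antichain hc h h2 h').symm
    · exact fun h' => h1 (lowerBoundary_antichain hc h2 h h')
  rw [cutProb, cutProb, e1 p, e2 p, e1 (posterior p u), e2 (posterior p u), e3, e4, e5,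
    posterior_self, edgeProb_eq]
  ring

/-- The parameter of `a` occurs in at most one factor, as `p a` or as `1 - p a`. This reduces the
total mass to parameters in `{0, 1}`. -/
theorem cutProb_affine (p : Node → ℝ) (c : Finset Node) (a : Node) :
    T.cutProb p c = p a * T.cutProb (Function.update p a 1) c +
      (1 - p a) * T.cutProb (Function.update p a 0) c := by
  have hsame : ∀ (s : Finset Node) (y : ℝ) (f : ℝ → ℝ), a ∉ s →
      ∏ i ∈ s, f (Function.update p a y i) = ∏ i ∈ s, f (p i) := by
    intro s y f hs
    refine Finset.prod_congr rfl fun i hi => ?_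
    rw [Function.update_of_ne]
    rintro rfl
    exact hs hi
  have hpull : ∀ (s : Finset Node) (p : Node → ℝ) (f : ℝ → ℝ), a ∈ s →
      ∏ i ∈ s, f (p i) = f (p a) * ∏ i ∈ s.erase a, f (p i) :=
    fun s p f hs => (Finset.mul_prod_erase s (fun i => f (p i)) hs).symm
  have hn : ∀ s : Finset Node, a ∉ s.erase a := fun s => Finset.notMem_erase a s
  unfold cutProb
  by_cases ha : a ∈ c
  · have hl : a ∉ T.lowerBoundary c := fun h => (mem_lowerBoundary.1 h).2.1 ha
    rw [hsame _ _ (fun y => y) hl, hsame _ _ (fun y => y) hl,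
      hpull c p (fun y => 1 - y) ha, hpull c (Function.update p a 1) (fun y => 1 - y) ha,
      hpull c (Function.update p a 0) (fun y => 1 - y) ha, hsame _ _ (fun y => 1 - y) (hn c),
      hsame _ _ (fun y => 1 - y) (hn c)]
    simp
    ring
  · rw [hsame _ _ (fun y => 1 - y) ha, hsame _ _ (fun y => 1 - y) ha]
    by_cases hl : a ∈ T.lowerBoundary c
    · rw [hpull _ p (fun y => y) hl, hpull _ (Function.update p a 1) (fun y => y) hl,
        hpull _ (Function.update p a 0) (fun y => y) hl, hsame _ _ (fun y => y) (hn _),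
        hsame _ _ (fun y => y) (hn _)]
      simp
      ring
    · rw [hsame _ _ (fun y => y) hl, hsame _ _ (fun y => y) hl]
      ring

theorem sum_cutProb_of_deterministic {p : Node → ℝ} (hl : ∀ i ∈ T.leaves, p i = 1)
    (hp : ∀ i ∈ T.internal, p i = 0 ∨ p i = 1) : ∑ c ∈ T.cuts, T.cutProb p c = 1 := by
  classical
  -- With 0/1 parameters only one cut has nonzero probability: the internal nodes at which, and
  -- above which, all parameters vanish.
  set c₀ := T.internal.filter fun i => ∀ j, j <:+ i → p j = 0 with hc₀
  have hmem : ∀ i, i ∈ c₀ ↔ i ∈ T.internal ∧ ∀ j, j <:+ i → p j = 0 := by simp [hc₀]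
  have hcut : c₀ ∈ T.cuts := by
    refine mem_cuts.2 ⟨Finset.filter_subset _ _, fun i hi => ?_⟩
    have ht : i.tail <:+ i := List.tail_suffix i
    rw [hmem] at hi ⊢
    refine ⟨?_, fun j hj => hi.2 j (hj.trans ht)⟩
    by_cases h : i.tail = i
    · rw [h]; exact hi.1
    · exact internal_of_proper ht h (mem_internal.1 hi.1).1
  rw [Finset.sum_eq_single_of_mem c₀ hcut]
  · rw [cutProb, Finset.prod_eq_one, Finset.prod_eq_one, one_mul]
    · intro v hv
      obtain ⟨h1, h2, h3⟩ := mem_lowerBoundary.1 hv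
      by_cases hvl : v ∈ T.leaves
      · exact hl v hvl
      · have hvi : v ∈ T.internal := mem_internal.2 ⟨h1, hvl⟩
        refine (hp v hvi).resolve_left fun h0 => h2 ((hmem v).2 ⟨hvi, fun j hj => ?_⟩)
        rcases suffix_cases hj with rfl | ⟨hne, hj⟩
        · exact h0
        · exact ((hmem _).1 (h3.resolve_left hne)).2 j hj
    · intro i hi
      rw [((hmem i).1 hi).2 i (List.suffix_refl _), sub_zero]
  · intro c hc hne
    by_contra h0
    refine hne (Finset.Subset.antisymm (fun i hi => ?_) (fun i hi => ?_))
    · refine (hmem i).2 ⟨(mem_cuts.1 hc).1 hi, fun j hj => ?_⟩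
      have hjc := cut_of_suffix hc hj hi
      exact (hp j ((mem_cuts.1 hc).1 hjc)).resolve_right fun h1 =>
        h0 (cutProb_eq_zero_of_mem hjc h1)
    · obtain ⟨h1, h2⟩ := (hmem i).1 hi
      by_contra hic
      obtain ⟨v, hv, hvi⟩ := exists_lowerBoundary (mem_internal.1 h1).1 hic
      exact h0 (cutProb_eq_zero_of_mem_lowerBoundary hv (h2 v hvi))

/-- The sum is affine in each parameter of an internal node, so it suffices to know it when these
parameters are all `0` or `1`. -/
theorem sum_cutProb {p : Node → ℝ} (hl : ∀ i ∈ T.leaves, p i = 1) :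
    ∑ c ∈ T.cuts, T.cutProb p c = 1 := by
  -- `S` contains the internal nodes whose parameters may still differ from `0` and `1`; the
  -- induction eliminates them one at a time.
  have main : ∀ S : Finset Node, ∀ p : Node → ℝ, (∀ i ∈ T.leaves, p i = 1) →
      (∀ i ∈ T.internal, i ∉ S → p i = 0 ∨ p i = 1) → ∑ c ∈ T.cuts, T.cutProb p c = 1 := by
    intro S
    induction S using Finset.induction_on with
    | empty => exact fun p hl hp => sum_cutProb_of_deterministic hl fun i hi => hp i hi (by simp)
    | insert a S ha ih =>
      intro p hl hp
      by_cases hai : a ∈ T.internal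
      · have aux : ∀ y : ℝ, (y = 0 ∨ y = 1) →
            ∑ c ∈ T.cuts, T.cutProb (Function.update p a y) c = 1 := by
          intro y hy
          apply ih
          · intro i hi
            rw [Function.update_of_ne, hl i hi]
            rintro rfl
            exact (mem_internal.1 hai).2 hi
          · intro i hi hiS
            by_cases h : i = a
            · subst h; simpa using hy
            · rw [Function.update_of_ne h]
              exact hp i hi (by simp [h, hiS])
        rw [Finset.sum_congr rfl fun c _ => cutProb_affine p c a, Finset.sum_add_distrib,
          ← Finset.mul_sum, ← Finset.mul_sum, aux 1 (Or.inr rfl), aux 0 (Or.inl rfl)]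
        ring
      · refine ih p hl fun i hi hiS => hp i hi ?_
        rw [Finset.mem_insert]
        rintro (rfl | h)
        · exact hai hi
        · exact hiS h
  exact main T.internal p hl fun i hi h => absurd hi h

theorem IsPrior.posterior {p : Node → ℝ} (hp : T.IsPrior p) {u : Node} (hu : u ∈ T.nodes) :
    T.IsPrior (posterior p u) := by
  refine ⟨fun i hi => ?_, fun i hi => ?_, fun i hi => ?_⟩
  · unfold WDP.posterior
    split_ifs
    exacts [zero_le_one, le_rfl, hp.nonneg i hi]
  · unfold WDP.posterior
    split_ifs
    exacts [le_rfl, zero_le_one, hp.le_one i hi]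
  · by_cases h : u <:+ i
    · exact posterior_below p h
    · rw [posterior_of_incomparable p h, hp.leaf i hi]
      intro h'
      exact h (eq_of_leaf_suffix hi h' hu ▸ List.suffix_refl _)

end BinTree

end WDP

end

/-! ### Expected cost of the weighted binary search -/

noncomputable section

namespace WDP

/-- An optimal split is balanced up to the weight of one of the two nodes next to it. -/
theorem abs_sub_le_of_bestSplit {q : Node → ℝ} {π : List Node} (hq : ∀ i ∈ π, 0 < q i) {k : ℕ}
    (hk : k ∈ bestSplits q π) :
    |((π.take (k + 1)).map q).sum - ((π.drop (k + 1)).map q).sum| ≤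
      q (π.getD k []) + q (π.getD (k + 1) []) := by
  obtain ⟨hr, hbest⟩ := mem_maximizers.1 hk
  rw [Finset.mem_range] at hr
  have hdec : ∀ j, ((π.take j).map q).sum + ((π.drop j).map q).sum = (π.map q).sum := by
    intro j
    rw [← List.sum_append, ← List.map_append, List.take_append_drop]
  have hstep : ∀ j, j < π.length →
      ((π.take (j + 1)).map q).sum = ((π.take j).map q).sum + q (π.getD j []) := by
    intro j hj
    rw [← List.take_concat_get' π j hj, List.map_append, List.sum_append,
      List.getD_eq_getElem π [] hj]
    simp
  have hnn : ∀ j, 0 ≤ ((π.drop j).map q).sum := by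
    intro j
    refine List.sum_nonneg fun y hy => ?_
    obtain ⟨i, hi, rfl⟩ := List.mem_map.1 hy
    exact (hq i (List.mem_of_mem_drop hi)).le
  have hnt : ∀ j, 0 ≤ ((π.take j).map q).sum := by
    intro j
    refine List.sum_nonneg fun y hy => ?_
    obtain ⟨i, hi, rfl⟩ := List.mem_map.1 hy
    exact (hq i (List.mem_of_mem_take hi)).le
  have hpos : ∀ j, j < π.length → 0 < q (π.getD j []) := by
    intro j hj
    rw [List.getD_eq_getElem π [] hj]
    exact hq _ (List.getElem_mem hj)
  have hd := hdec (k + 1)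
  have hk0 := hpos k (by omega)
  have hk1 := hpos (k + 1) (by omega)
  have hs0 := hstep k (by omega)
  have hs1 := hstep (k + 1) (by omega)
  have hb : ∀ j, j < π.length - 1 → deviation q π k ≤ deviation q π j := fun j hj =>
    neg_le_neg_iff.1 (hbest j (Finset.mem_range.2 hj))
  unfold deviation at hb
  set A := ((π.take (k + 1)).map q).sum
  set B := ((π.drop (k + 1)).map q).sum
  rw [← hd] at hb
  -- If the lower part is heavier, moving its top node `i_k` to the other side cannot improve the
  -- split, so the excess is at most `q (i_k)`; for `k = 0` the lower part is `i_0` alone. The other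
  -- case is symmetric, with `i_(k+1)`.
  rcases le_total B A with hAB | hAB
  · rw [abs_of_nonneg (by linarith)]
    rcases Nat.eq_zero_or_pos k with rfl | hk
    · simp only [List.take_zero, List.map_nil, List.sum_nil] at hs0
      linarith [hnn 1, hnn (0 + 1)]
    · have h1 := hb (k - 1) (by omega)
      rw [Nat.sub_add_cancel hk] at h1
      rw [abs_of_nonpos (by linarith : (A + B) / 2 - A ≤ 0)] at h1
      rcases le_abs.1 h1 with h1 | h1 <;> linarith
  · rw [abs_of_nonpos (by linarith)]
    by_cases hlast : k + 2 < π.length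
    · have h1 := hb (k + 1) (by omega)
      rw [abs_of_nonneg (by linarith : 0 ≤ (A + B) / 2 - A)] at h1
      rcases le_abs.1 h1 with h1 | h1 <;> linarith
    · have h2 := hdec (k + 1 + 1)
      rw [List.drop_of_length_le (by omega : π.length ≤ k + 1 + 1)] at h2
      simp only [List.map_nil, List.sum_nil] at h2
      linarith [hnt (k + 1)]

/-- The term `x + y - |x - y|` is `2 min(x, y)`. From `4mn ≤ (m + n)²` one gets `log m + log n + 2 ≤
2 log (m + n)`; weight this by `min(x, y)`, and bound the logarithm on the heavier side by `log (m +
n)` for the surplus `|x - y|`. -/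
theorem two_mul_min_le_of_log {x y : ℝ} (hx : 0 ≤ x) (hy : 0 ≤ y) {m n : ℕ} (hm : 0 < m)
    (hn : 0 < n) :
    x * Real.logb 2 m + y * Real.logb 2 n + (x + y - |x - y|) ≤
      (x + y) * Real.logb 2 ((m + n : ℕ) : ℝ) := by
  have hm' : (1 : ℝ) ≤ m := by exact_mod_cast hm
  have hn' : (1 : ℝ) ≤ n := by exact_mod_cast hn
  have h2 : (1 : ℝ) < 2 := by norm_num
  have hs : Real.logb 2 m + Real.logb 2 n + 2 ≤ 2 * Real.logb 2 ((m + n : ℕ) : ℝ) := by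
    have h4 : (2 : ℝ) = Real.logb 2 4 := by
      rw [show (4 : ℝ) = 2 ^ (2 : ℕ) by norm_num, Real.logb_pow, Real.logb_self_eq_one h2]
      norm_num
    have e : 2 * Real.logb 2 ((m + n : ℕ) : ℝ) = Real.logb 2 (((m + n : ℕ) : ℝ) ^ 2) := by
      rw [Real.logb_pow]; norm_num
    rw [e]
    nth_rewrite 3 [h4]
    rw [← Real.logb_mul (by positivity) (by positivity),
      ← Real.logb_mul (by positivity) (by positivity)]
    apply Real.logb_le_logb_of_le h2 (by positivity)
    push_cast
    nlinarith [sq_nonneg ((m : ℝ) - n)]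
  have hmm : Real.logb 2 m ≤ Real.logb 2 ((m + n : ℕ) : ℝ) :=
    Real.logb_le_logb_of_le h2 (by linarith) (by push_cast; linarith)
  have hnn : Real.logb 2 n ≤ Real.logb 2 ((m + n : ℕ) : ℝ) :=
    Real.logb_le_logb_of_le h2 (by linarith) (by push_cast; linarith)
  rcases le_total x y with h | h
  · rw [abs_of_nonpos (by linarith)]
    nlinarith [mul_le_mul_of_nonneg_left hs hx, mul_le_mul_of_nonneg_left hnn (sub_nonneg.2 h)]
  · rw [abs_of_nonneg (by linarith)]
    nlinarith [mul_le_mul_of_nonneg_left hs hy, mul_le_mul_of_nonneg_left hmm (sub_nonneg.2 h)]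

/-- Binary search on a segment of a path finds the node whose parent edge is cut; its transcript
depends on that node only, and its expected length is logarithmic. -/
theorem binarySearch_spec (T : BinTree) (ch : Choices) (q : Node → ℝ) (π : List Node)
    (hne : π ≠ []) (hch : π.Pairwise fun i j => j <:+ i ∧ j ≠ i) (hπ : ∀ i ∈ π, i ∈ T.nodes)
    (hq : ∀ i ∈ π, 0 < q i) (H : History) :
    ∃ R : Node → History,
      (∀ u ∈ π, ∀ c ∈ T.cuts, u ∈ T.lowerBoundary c →
        binarySearch T ch (T.similarity c) q π H = (u, R u)) ∧
      (π.map fun u => q u * ((R u).length - H.length)).sum ≤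
        (π.map q).sum * Real.logb 2 π.length + 2 * (π.map q).sum - q (π.getD 0 []) -
          q (π.getD (π.length - 1) []) := by
  by_cases hlen : 2 ≤ π.length
  · have hkmem : splitIndex ch q π H ∈ bestSplits q π := ch.split.pick_mem H _
      (maximizers_nonempty ⟨0, Finset.mem_range.2 (by omega)⟩ _)
    have hklt := splitIndex_lt ch q π H hlen
    have hbal := abs_sub_le_of_bestSplit hq hkmem
    set k := splitIndex ch q π H with hk
    set i := π.getD (k + 1) [] with hi
    have hi' : i = π[k + 1] := List.getD_eq_getElem π [] hklt
    set xy := ch.pair.pick H (T.queryPairs i) with hxy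
    have hsplit : π = π.take (k + 1) ++ π.drop (k + 1) := (List.take_append_drop _ _).symm
    have hdropeq : π.drop (k + 1) = i :: π.drop (k + 1 + 1) := by
      rw [hi']; exact List.drop_eq_getElem_cons hklt
    have hcross : ∀ a ∈ π.take (k + 1), ∀ b ∈ π.drop (k + 1), b <:+ a ∧ b ≠ a := by
      rw [hsplit, List.pairwise_append] at hch
      exact hch.2.2
    have hiD : i ∈ π.drop (k + 1) := by rw [hdropeq]; exact List.mem_cons_self
    have hx0 : π[0] ∈ π.take (k + 1) := by
      rw [List.mem_take_iff_getElem]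
      exact ⟨0, by omega, rfl⟩
    have hiint : i ∈ T.internal :=
      BinTree.internal_of_proper (hcross _ hx0 _ hiD).1 (hcross _ hx0 _ hiD).2
        (hπ _ (List.getElem_mem _))
    have hpick : xy ∈ T.queryPairs i := ch.pair.pick_mem H _ (BinTree.queryPairs_nonempty hiint)
    have hlenT : (π.take (k + 1)).length = k + 1 := by rw [List.length_take]; omega
    have hlenD : (π.drop (k + 1)).length = π.length - (k + 1) := List.length_drop
    -- The answer is fixed to `1` here and to `-1` for the lower half, so the resulting transcripts
    -- depend on the node found and not on the cut.
    obtain ⟨R₁, hR₁, hb₁⟩ := binarySearch_spec T ch q (π.drop (k + 1))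
      (by rw [hdropeq]; simp) (hch.sublist (List.drop_sublist _ _))
      (fun j hj => hπ j (List.mem_of_mem_drop hj)) (fun j hj => hq j (List.mem_of_mem_drop hj))
      ((xy.1, xy.2, 1) :: H)
    obtain ⟨R₂, hR₂, hb₂⟩ := binarySearch_spec T ch q (π.take (k + 1))
      (List.ne_nil_of_mem hx0) (hch.sublist (List.take_sublist _ _))
      (fun j hj => hπ j (List.mem_of_mem_take hj)) (fun j hj => hq j (List.mem_of_mem_take hj))
      ((xy.1, xy.2, -1) :: H)
    refine ⟨fun u => if u ∈ π.drop (k + 1) then R₁ u else R₂ u, ?_, ?_⟩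
    · intro u hu c hc huc
      have hsim := BinTree.similarity_queryPairs hc hpick (BinTree.mem_internal.1 hiint).1
      rw [binarySearch, dif_pos hlen]
      dsimp only
      rw [← hk, ← hi, ← hxy]
      by_cases huD : u ∈ π.drop (k + 1)
      · have hui : u <:+ i := by
          have hch' := hch.sublist (List.drop_sublist (k + 1) π)
          rw [hdropeq, List.pairwise_cons] at hch'
          rw [hdropeq, List.mem_cons] at huD
          rcases huD with rfl | h
          · exact List.suffix_refl _
          · exact (hch'.1 u h).1
        have h1 := hsim.2 (BinTree.below_of_suffix hc huc hui)
        rw [h1, if_pos rfl, if_pos huD]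
        exact hR₁ u huD c hc huc
      · have huT : u ∈ π.take (k + 1) := by
          rw [hsplit, List.mem_append] at hu
          exact hu.resolve_right huD
        have hic := BinTree.above_of_proper hc huc (hcross u huT i hiD).1 (hcross u huT i hiD).2
        have h1 : T.similarity c xy.1 xy.2 ≠ 1 := fun h => hsim.1 h hic
        have h2 : T.similarity c xy.1 xy.2 = -1 := by
          exact (ite_eq_or_eq _ _ _).resolve_left h1
        rw [if_neg h1, h2, if_neg huD]
        exact hR₂ u huT c hc huc
    -- The query costs `A + B = 2 min(A, B) + |A - B|`. The logarithms absorb `2 min(A, B)`, and the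
    -- inner end weights `q (i_k)` and `q (i_(k+1))`, subtracted in the bounds for the halves,
    -- absorb `|A - B|`.
    · set A := ((π.take (k + 1)).map q).sum with hA
      set B := ((π.drop (k + 1)).map q).sum with hB
      have hAB : (π.map q).sum = A + B := by
        conv_lhs => rw [hsplit]
        rw [List.map_append, List.sum_append]
      have e1 : ((π.drop (k + 1)).map fun u => q u *
          (((if u ∈ π.drop (k + 1) then R₁ u else R₂ u).length : ℝ) - H.length)).sum =
          ((π.drop (k + 1)).map fun u => q u *
            ((R₁ u).length - ((xy.1, xy.2, (1 : ℤ)) :: H).length)).sum + B := by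
        rw [hB, ← List.sum_map_add]
        refine congrArg _ (List.map_congr_left fun u hu => ?_)
        rw [if_pos hu, List.length_cons]
        push_cast
        ring
      have e2 : ((π.take (k + 1)).map fun u => q u *
          (((if u ∈ π.drop (k + 1) then R₁ u else R₂ u).length : ℝ) - H.length)).sum =
          ((π.take (k + 1)).map fun u => q u *
            ((R₂ u).length - ((xy.1, xy.2, (-1 : ℤ)) :: H).length)).sum + A := by
        rw [hA, ← List.sum_map_add]
        refine congrArg _ (List.map_congr_left fun u hu => ?_)
        rw [if_neg fun h => (hcross u hu u h).2 rfl, List.length_cons]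
        push_cast
        ring
      have e3 : (π.map fun u => q u *
          (((if u ∈ π.drop (k + 1) then R₁ u else R₂ u).length : ℝ) - H.length)).sum =
          ((π.take (k + 1)).map fun u => q u *
            (((if u ∈ π.drop (k + 1) then R₁ u else R₂ u).length : ℝ) - H.length)).sum +
          ((π.drop (k + 1)).map fun u => q u *
            (((if u ∈ π.drop (k + 1) then R₁ u else R₂ u).length : ℝ) - H.length)).sum := by
        rw [← List.sum_append, ← List.map_append, ← hsplit]
      have hA0 : 0 ≤ A := List.sum_nonneg fun y hy => by
        obtain ⟨j, hj, rfl⟩ := List.mem_map.1 hy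
        exact (hq j (List.mem_of_mem_take hj)).le
      have hB0 : 0 ≤ B := List.sum_nonneg fun y hy => by
        obtain ⟨j, hj, rfl⟩ := List.mem_map.1 hy
        exact (hq j (List.mem_of_mem_drop hj)).le
      have hlog := two_mul_min_le_of_log hA0 hB0 (m := k + 1) (n := π.length - (k + 1))
        (by omega) (by omega)
      rw [show k + 1 + (π.length - (k + 1)) = π.length by omega] at hlog
      have g1 : (π.drop (k + 1)).getD 0 [] = i := by rw [hdropeq]; rfl
      have g2 : (π.drop (k + 1)).getD (π.length - (k + 1) - 1) [] =
          π.getD (π.length - 1) [] := by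
        simp only [List.getD_eq_getElem?_getD, List.getElem?_drop]
        rw [show k + 1 + (π.length - (k + 1) - 1) = π.length - 1 by omega]
      have g3 : (π.take (k + 1)).getD 0 [] = π.getD 0 [] := by
        simp [List.getD_eq_getElem?_getD]
      have g4 : (π.take (k + 1)).getD (k + 1 - 1) [] = π.getD k [] := by
        simp [List.getD_eq_getElem?_getD]
      rw [hlenD, g1, g2] at hb₁
      rw [hlenT, g3, g4] at hb₂
      rw [e3, e1, e2, hAB]
      linarith
  · obtain ⟨x, rfl⟩ : ∃ x, π = [x] := by
      rw [← List.length_eq_one_iff]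
      have := List.length_pos_iff.2 hne
      omega
    refine ⟨fun _ => H, fun u hu c _ _ => ?_, ?_⟩
    · rw [binarySearch, dif_neg hlen, List.mem_singleton.1 hu]
      rfl
    -- For a single node both ends coincide and the bound is exactly `0`.
    · simp
      linarith
termination_by π.length
decreasing_by
  · have := splitIndex_lt ch q π H hlen
    rw [List.length_drop]
    omega
  · have := splitIndex_lt ch q π H hlen
    rw [List.length_take]
    omega

end WDP

end

/-! ### The invariant of the main loop -/

noncomputable section

namespace WDP

theorem mem_hanging {u r s : Node} :
    s ∈ hanging u r ↔ ∃ b a, s = (!b) :: a ∧ b :: a <:+ u ∧ r <:+ a := by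
  simp only [hanging, List.mem_toFinset, List.mem_map, List.mem_filter, mem_path, decide_eq_true_eq]
  constructor
  · rintro ⟨j, ⟨⟨hju, hrj⟩, hne⟩, rfl⟩
    cases j with
    | nil => exact absurd (List.suffix_nil.1 hrj).symm hne
    | cons b a => exact ⟨b, a, rfl, hju, suffix_tail hrj (Ne.symm hne)⟩
  · rintro ⟨b, a, rfl, hu, hr⟩
    refine ⟨b :: a, ⟨⟨hu, hr.trans (List.suffix_cons b a)⟩, ?_⟩, rfl⟩
    rintro rfl
    have := hr.length_le
    simp at this

/-- Incomparable nodes below `r` are separated by a node hanging off the path to `r`. -/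
theorem exists_hanging {u r i : Node} (hru : r <:+ u) (hri : r <:+ i) (h : ¬ u <:+ i)
    (h' : ¬ i <:+ u) : ∃ s ∈ hanging u r, s <:+ i := by
  induction i with
  | nil => exact absurd (List.nil_suffix) h'
  | cons d t ih =>
    have hne : r ≠ d :: t := by
      rintro rfl
      exact h' hru
    have hrt : r <:+ t := suffix_tail hri hne
    have hut : ¬ u <:+ t := fun hh => h (hh.trans (List.suffix_cons d t))
    by_cases htu : t <:+ u
    · have htu' : t ≠ u := by
        rintro rfl
        exact hut (List.suffix_refl _)
      -- Here `t` is above `u` but its child `d :: t` is not, so the path to `u` goes through the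
      -- other child of `t`.
      refine ⟨d :: t, mem_hanging.2 ⟨!d, t, by simp, ?_, hrt⟩, List.suffix_refl _⟩
      obtain ⟨l, hl⟩ := htu
      rcases List.eq_nil_or_concat l with rfl | ⟨l', b, rfl⟩
      · exact absurd (by simpa using hl) htu'
      · have hb : b :: t <:+ u := ⟨l', by simpa using hl⟩
        rcases Bool.eq_or_eq_not b d with rfl | rfl
        · exact absurd hb h'
        · exact hb
    · obtain ⟨s, hs, hst⟩ := ih hrt hut htu
      exact ⟨s, hs, hst.trans (List.suffix_cons d t)⟩

/-- The state after a round that has searched the tree rooted at `r` and found the node `u`. -/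
def nextState (T : BinTree) (s : State) (u r : Node) (H : History) : State where
  clusters := insert (T.leavesBelow u) s.clusters ∪
    ((hanging u r).filter fun i => i ∈ T.leaves).image fun x => {x}
  forest := s.forest.erase r ∪ (hanging u r).filter fun i => i ∉ T.leaves
  p := posterior s.p u
  history := H

/-- The invariant of the main loop. -/
structure Inv (T : BinTree) (s : State) : Prop where
  prior : T.IsPrior s.p
  mem_nodes : ∀ r ∈ s.forest, r ∈ T.nodes
  -- Only the initial forest of a one-node tree contains a trivial tree; hanging leaves are recorded
  -- as clusters at once.
  leaf_eq : ∀ r ∈ s.forest, r ∈ T.leaves → r = []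
  antichain : ∀ r ∈ s.forest, ∀ r' ∈ s.forest, r <:+ r' → r = r'
  -- The cut is known to pass at or below each root of the forest, so `aboveProb` equals `1` there
  -- and the weights of a searched path sum to `1`.
  above : ∀ r ∈ s.forest, ∀ k, k <:+ r → k ≠ r → s.p k = 0
  inside : ∀ i ∈ T.internal, (∃ r ∈ s.forest, r <:+ i) → 0 < s.p i ∧ s.p i < 1
  clusters : ∀ c ∈ T.cuts, T.cutProb s.p c ≠ 0 → ∀ C, C ∈ T.clustering c ↔
    C ∈ s.clusters ∨ ∃ i ∈ T.lowerBoundary c, (∃ r ∈ s.forest, r <:+ i) ∧ C = T.leavesBelow i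

variable {T : BinTree} {s : State}

theorem mem_nextState_forest {u r k : Node} {H : History} :
    k ∈ (nextState T s u r H).forest ↔
      (k ≠ r ∧ k ∈ s.forest) ∨ (k ∈ hanging u r ∧ k ∉ T.leaves) := by
  simp [nextState]

namespace Inv

theorem covered {r u i k : Node} (hr : r ∈ s.forest) {H : History}
    (hk : k ∈ (nextState T s u r H).forest) (hki : k <:+ i) : ∃ r' ∈ s.forest, r' <:+ i := by
  rcases mem_nextState_forest.1 hk with ⟨-, h⟩ | ⟨h, -⟩
  · exact ⟨k, h, hki⟩
  · obtain ⟨b, a, rfl, -, h2⟩ := mem_hanging.1 h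
    exact ⟨r, hr, (h2.trans (List.suffix_cons _ _)).trans hki⟩

/-- A remaining old root above `z` would be comparable with `r`, against the antichain property; a
hanging node above `z` and its sibling would be distinct suffixes of `z` of equal length. Hence the
posterior changes no parameter inside the remaining trees, and the path from `u` up to `r` leaves
the forest. -/
theorem separated (hs : Inv T s) {r u z k : Node} (hr : r ∈ s.forest) (hru : r <:+ u)
    {H : History} (hk : k ∈ (nextState T s u r H).forest) (huz : u <:+ z) : ¬ k <:+ z := by
  intro hkz
  rcases mem_nextState_forest.1 hk with ⟨hne, h⟩ | ⟨h, -⟩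
  · rcases suffix_total hkz (hru.trans huz) with h' | h'
    · exact hne (hs.antichain k h r hr h')
    · exact hne (hs.antichain r hr k h h').symm
  · obtain ⟨b, a, rfl, h1, -⟩ := mem_hanging.1 h
    rcases suffix_total hkz (h1.trans huz) with h' | h' <;>
    · have := h'.eq_of_length (by simp)
      simp at this

theorem p_eq (hs : Inv T s) {r u i k : Node} (hr : r ∈ s.forest) (hru : r <:+ u)
    {H : History} (hk : k ∈ (nextState T s u r H).forest) (hki : k <:+ i) :
    posterior s.p u i = s.p i := by
  apply BinTree.posterior_of_incomparable
  · exact fun h => hs.separated hr hru hk h hki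
  · exact fun h => hs.separated hr hru hk (List.suffix_refl u) (hki.trans h)

theorem lt_one (hs : Inv T s) {r k z : Node} (hr : r ∈ s.forest) (hk : k <:+ z) (hrz : r <:+ z)
    (hki : k ∈ T.internal) : s.p k < 1 := by
  by_cases h : r <:+ k
  · exact (hs.inside k hki ⟨r, hr, h⟩).2
  · rw [hs.above r hr k ((suffix_total hk hrz).resolve_right h)]
    · exact zero_lt_one
    · rintro rfl
      exact h (List.suffix_refl _)

theorem p_pos (hs : Inv T s) {r i : Node} (hr : r ∈ s.forest) (hri : r <:+ i)
    (hi : i ∈ T.nodes) : 0 < s.p i := by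
  by_cases h : i ∈ T.leaves
  · rw [hs.prior.leaf i h]
    exact zero_lt_one
  · exact (hs.inside i (BinTree.mem_internal.2 ⟨hi, h⟩) ⟨r, hr, hri⟩).1

theorem edgeProb_pos (hs : Inv T s) {r i : Node} (hr : r ∈ s.forest) (hri : r <:+ i)
    (hi : i ∈ T.nodes) : 0 < edgeProb s.p i :=
  WDP.edgeProb_pos (fun _ hk hne => hs.lt_one hr hk hri (BinTree.internal_of_proper hk hne hi))
    (hs.p_pos hr hri hi)

theorem lowerBoundary_of_ne_zero {c : Finset Node} {u : Node} {p : Node → ℝ} (hu : u ∈ T.nodes)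
    (h : T.cutProb (posterior p u) c ≠ 0) : u ∈ T.lowerBoundary c := by
  by_contra h'
  exact h (BinTree.cutProb_posterior_of_not_mem hu h')

theorem next (hs : Inv T s) {r u : Node} (hr : r ∈ s.forest) (hru : r <:+ u) (hu : u ∈ T.nodes)
    (H : History) : Inv T (nextState T s u r H) where
  prior := hs.prior.posterior hu
  mem_nodes k hk := by
    rcases mem_nextState_forest.1 hk with ⟨-, h⟩ | ⟨h, -⟩
    · exact hs.mem_nodes k h
    · obtain ⟨b, a, rfl, h1, -⟩ := mem_hanging.1 h
      exact T.sibling_mem _ _ (BinTree.mem_of_suffix h1 hu)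
  leaf_eq k hk hl := by
    rcases mem_nextState_forest.1 hk with ⟨-, h⟩ | ⟨-, h⟩
    · exact hs.leaf_eq k h hl
    · exact absurd hl h
  antichain k hk k' hk' h := by
    by_contra hne
    rcases mem_nextState_forest.1 hk' with ⟨hne', h'⟩ | ⟨h', -⟩
    · rcases mem_nextState_forest.1 hk with ⟨-, h''⟩ | ⟨h'', -⟩
      · exact hne (hs.antichain k h'' k' h' h)
      · obtain ⟨b, a, rfl, -, h2⟩ := mem_hanging.1 h''
        exact hne' (hs.antichain r hr k' h' ((h2.trans (List.suffix_cons _ _)).trans h)).symm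
    · obtain ⟨b, a, rfl, h1, -⟩ := mem_hanging.1 h'
      exact hs.separated hr hru hk (List.suffix_refl u)
        ((suffix_tail h hne).trans ((List.suffix_cons b a).trans h1))
  above k hk j hj hne := by
    rcases mem_nextState_forest.1 hk with ⟨-, h⟩ | ⟨h, -⟩
    · by_cases hju : j <:+ u
      · refine BinTree.posterior_above s.p hju ?_
        rintro rfl
        exact hs.separated hr hru hk hj (List.suffix_refl k)
      · have : ¬ u <:+ j := fun h' =>
          hs.separated hr hru hk (h'.trans hj) (List.suffix_refl k)
        change posterior s.p u j = 0
        rw [BinTree.posterior_of_incomparable s.p this hju, hs.above k h j hj hne]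
    · obtain ⟨b, a, rfl, h1, -⟩ := mem_hanging.1 h
      have hja : j <:+ a := suffix_tail hj hne
      have hj' : j <:+ b :: a := hja.trans (List.suffix_cons b a)
      refine BinTree.posterior_above s.p (hj'.trans h1) ?_
      rintro rfl
      have := (h1.trans hja).length_le
      simp at this
  inside i hi := by
    rintro ⟨k, hk, hki⟩
    change 0 < posterior s.p u i ∧ posterior s.p u i < 1
    rw [hs.p_eq hr hru hk hki]
    exact hs.inside i hi (covered hr hk hki)
  -- Positive posterior probability forces `u` onto the boundary of `c`. Any other boundary node of
  -- the searched tree is incomparable with `u`, hence lies below a node hanging off the path.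
  clusters c hc h0 C := by
    have huc : u ∈ T.lowerBoundary c := lowerBoundary_of_ne_zero hu h0
    have h1 : T.cutProb s.p c ≠ 0 := by
      rw [BinTree.cutProb_eq_mul_posterior hc huc]
      exact mul_ne_zero (hs.edgeProb_pos hr hru hu).ne' h0
    rw [hs.clusters c hc h1 C]
    have hmem : C ∈ (nextState T s u r H).clusters ↔ C = T.leavesBelow u ∨ C ∈ s.clusters ∨
        ∃ x ∈ hanging u r, x ∈ T.leaves ∧ C = {x} := by
      simp only [nextState, Finset.mem_union, Finset.mem_insert, Finset.mem_image,
        Finset.mem_filter, or_assoc, and_assoc, eq_comm (a := C)]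
    rw [hmem]
    constructor
    · rintro (h | ⟨i, hi, ⟨r', hr', hri'⟩, rfl⟩)
      · exact Or.inl (Or.inr (Or.inl h))
      · by_cases hui : u = i
        · exact Or.inl (Or.inl (by rw [hui]))
        by_cases hrr : r' = r
        · subst hrr
          obtain ⟨x, hx, hxi⟩ := exists_hanging hru hri'
            (fun h => hui (BinTree.lowerBoundary_antichain hc huc hi h))
            (fun h => hui (BinTree.lowerBoundary_antichain hc hi huc h).symm)
          by_cases hxl : x ∈ T.leaves
          · have hxi' := BinTree.eq_of_leaf_suffix hxl hxi (BinTree.mem_lowerBoundary.1 hi).1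
            subst hxi'
            exact Or.inl (Or.inr (Or.inr ⟨x, hx, hxl, BinTree.leavesBelow_leaf hxl⟩))
          · exact Or.inr ⟨i, hi, ⟨x, mem_nextState_forest.2 (Or.inr ⟨hx, hxl⟩), hxi⟩, rfl⟩
        · exact Or.inr ⟨i, hi, ⟨r', mem_nextState_forest.2 (Or.inl ⟨hrr, hr'⟩), hri'⟩, rfl⟩
    · rintro ((rfl | h | ⟨x, hx, hxl, rfl⟩) | ⟨i, hi, ⟨k, hk, hki⟩, rfl⟩)
      · exact Or.inr ⟨u, huc, ⟨r, hr, hru⟩, rfl⟩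
      · exact Or.inl h
      -- A hanging leaf is itself on the boundary: its parent is a proper ancestor of `u`, hence
      -- above the cut.
      · obtain ⟨b, a, rfl, h2, h3⟩ := mem_hanging.1 hx
        refine Or.inr ⟨_, BinTree.mem_lowerBoundary.2 ⟨(BinTree.mem_leaves.1 hxl).1,
          BinTree.leaf_not_mem_cut hc hxl, Or.inr ?_⟩, ⟨r, hr, h3.trans (List.suffix_cons _ _)⟩,
          (BinTree.leavesBelow_leaf hxl).symm⟩
        refine BinTree.above_of_proper hc huc ((List.suffix_cons b a).trans h2) ?_
        rintro h
        have := h2.length_le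
        rw [← h] at this
        simp at this
      · exact Or.inr ⟨i, hi, covered hr hk hki, rfl⟩

end Inv

/-! ### Charging rounds to leaves of `T'_c` -/

/-- The leaves of the subtree `T'_c`. -/
def BinTree.coreLeaves (T : BinTree) (c : Finset Node) : Finset Node :=
  (T.core c).filter fun i => ∀ b : Bool, b :: i ∉ T.core c

/-- The nodes in a set that belong to a tree of the forest. -/
def under (A F : Finset Node) : Finset Node := A.filter fun i => ∃ r ∈ F, r <:+ i

theorem mem_under {A F : Finset Node} {i : Node} :
    i ∈ under A F ↔ i ∈ A ∧ ∃ r ∈ F, r <:+ i := by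
  simp [under]

/-- A round removes from the forest all nodes on the path above the node found. -/
theorem Inv.under_nextState_lt (hs : Inv T s) {r u i : Node} (hr : r ∈ s.forest)
    (hru : r <:+ u) {A : Finset Node} (hi : i ∈ A) (hri : r <:+ i) (hiu : i <:+ u) (H : History) :
    (under A (nextState T s u r H).forest).card < (under A s.forest).card := by
  apply Finset.card_lt_card
  rw [Finset.ssubset_iff_of_subset]
  · refine ⟨i, mem_under.2 ⟨hi, r, hr, hri⟩, fun h => ?_⟩
    obtain ⟨-, k, hk, hki⟩ := mem_under.1 h
    exact hs.separated hr hru hk (List.suffix_refl u) (hki.trans hiu)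
  · intro j hj
    obtain ⟨h, k, hk, hkj⟩ := mem_under.1 hj
    exact mem_under.2 ⟨h, Inv.covered hr hk hkj⟩

/-- The search of a path whose bottom leaf has a leaf as its sibling ends next to a leaf of
`T'_c`. -/
theorem exists_coreLeaf {c : Finset Node} (hc : c ∈ T.cuts) {r u : Node}
    (hr : r ∈ T.internal) (hru : r <:+ u) (hu : u ∈ T.lowerBoundary c)
    (hsib : ∀ b a, u = b :: a → u ∈ T.leaves → (!b) :: a ∈ T.leaves) :
    ∃ i ∈ T.coreLeaves c, r <:+ i ∧ i <:+ u := by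
  have hcore : ∀ j, j ∈ T.core c ↔ (j ∈ c ∨ j ∈ T.lowerBoundary c) ∧ j ∉ T.leaves := by
    intro j
    simp [BinTree.core]
  -- If `u` is an item, both children of its parent are items and are dropped from `T'_c`, so the
  -- parent is a leaf of `T'_c`. Otherwise `u` itself is one, having no descendants there.
  by_cases hul : u ∈ T.leaves
  · cases u with
    | nil => exact absurd (List.suffix_nil.1 hru ▸ hul) (BinTree.mem_internal.1 hr).2
    | cons b a =>
      have hsl := hsib b a rfl hul
      have hra : r <:+ a := by
        refine suffix_tail hru ?_
        rintro rfl
        exact (BinTree.mem_internal.1 hr).2 hul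
      have hac : a ∈ c := by simpa using (BinTree.mem_lowerBoundary.1 hu).2.2
      refine ⟨a, ?_, hra, List.suffix_cons b a⟩
      rw [BinTree.coreLeaves, Finset.mem_filter]
      refine ⟨(hcore a).2 ⟨Or.inl hac, fun h => BinTree.leaf_not_mem_cut hc h hac⟩,
        fun d hd => ((hcore _).1 hd).2 ?_⟩
      rcases Bool.eq_or_eq_not d b with rfl | rfl
      · exact hul
      · exact hsl
  · refine ⟨u, ?_, hru, List.suffix_refl _⟩
    rw [BinTree.coreLeaves, Finset.mem_filter]
    refine ⟨(hcore u).2 ⟨Or.inr hu, hul⟩, fun d hd => ?_⟩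
    have huc := (BinTree.mem_lowerBoundary.1 hu).2.1
    rcases ((hcore _).1 hd).1 with h | h
    · exact huc ((BinTree.mem_cuts.1 hc).2 _ h)
    · exact huc (by simpa using (BinTree.mem_lowerBoundary.1 h).2.2)

theorem mem_maxEntropyPaths {p : Node → ℝ} {F : Finset Node} {e : Node × Node} :
    e ∈ T.maxEntropyPaths p F ↔ (e.1 ∈ T.leaves ∧ e.2 ∈ F ∧ e.2 <:+ e.1) ∧
      ∀ x ∈ T.leaves, ∀ r ∈ F, r <:+ x →
        pathEntropy p (path x r) ≤ pathEntropy p (path e.1 e.2) := by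
  simp [BinTree.maxEntropyPaths, mem_maximizers, BinTree.forestPaths, and_assoc]
  tauto

/-- The bottom leaf of a path of maximum entropy has a leaf as its sibling. -/
theorem Inv.sibling_leaf (hs : Inv T s) {r a : Node} {b : Bool}
    (he : (b :: a, r) ∈ T.maxEntropyPaths s.p s.forest) (hr : r ∈ T.internal) :
    (!b) :: a ∈ T.leaves := by
  obtain ⟨⟨hx, hrF, hrx⟩, hmax⟩ := mem_maxEntropyPaths.1 he
  dsimp only at hx hrF hrx hmax
  by_contra hsl
  have hsi : (!b) :: a ∈ T.internal :=
    BinTree.mem_internal.2 ⟨T.sibling_mem _ _ (BinTree.mem_leaves.1 hx).1, hsl⟩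
  have hra : r <:+ a := by
    refine suffix_tail hrx ?_
    rintro rfl
    exact (BinTree.mem_internal.1 hr).2 hx
  obtain ⟨x, hxl, hsx⟩ := BinTree.exists_leaf_below (BinTree.mem_internal.1 hsi).1
  have hrs : r <:+ (!b) :: a := hra.trans (List.suffix_cons _ _)
  have hxn := (BinTree.mem_leaves.1 hxl).1
  refine (hmax x hxl r hrF (hrs.trans hsx)).not_gt ?_
  exact pathEntropy_lt hra (hs.prior.leaf _ hx) hsx (hs.prior.leaf _ hxl)
    (hs.inside _ hsi ⟨r, hrF, hrs⟩).2
    (fun k hk hne => hs.lt_one hrF hk (hrs.trans hsx) (BinTree.internal_of_proper hk hne hxn))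
    (fun k hk hsk => hs.p_pos hrF (hrs.trans hsk) (BinTree.mem_of_suffix hk hxn))

/-- Nothing is lost at either end of the telescoping sum: the proper ancestors of `r` have parameter
`0` and the leaf `x` has parameter `1`. So the weights form the law of the node that the search
finds. -/
theorem Inv.sum_edgeProb (hs : Inv T s) {r x : Node} (hr : r ∈ s.forest) (hrx : r <:+ x)
    (hx : x ∈ T.leaves) : ((path x r).map (edgeProb s.p)).sum = 1 := by
  have h := sum_edgeProb_path s.p hrx
  rwa [hs.prior.leaf x hx, sub_self, zero_mul, add_zero, aboveProb_eq_one (hs.above r hr)] at h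

/-- A path searched by the algorithm crosses every cut of positive posterior probability. -/
theorem Inv.exists_mem_path (hs : Inv T s) {r x : Node} (hr : r ∈ s.forest) (hrx : r <:+ x)
    (hx : x ∈ T.leaves) {c : Finset Node} (hc : c ∈ T.cuts) (h0 : T.cutProb s.p c ≠ 0) :
    ∃ u ∈ path x r, u ∈ T.lowerBoundary c := by
  obtain ⟨u, hu, hux⟩ := BinTree.exists_lowerBoundary (BinTree.mem_leaves.1 hx).1
    (BinTree.leaf_not_mem_cut hc hx)
  refine ⟨u, mem_path.2 ⟨hux, ?_⟩, hu⟩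
  -- A boundary node strictly above `r` would have parameter `0`.
  by_contra h
  refine h0 (BinTree.cutProb_eq_zero_of_mem_lowerBoundary hu
    (hs.above r hr u ((suffix_total hux hrx).resolve_right h) ?_))
  rintro rfl
  exact h (List.suffix_refl _)

theorem eq_of_mem_path {c : Finset Node} (hc : c ∈ T.cuts) {x r u v : Node}
    (hu : u ∈ path x r) (hv : v ∈ path x r) (huc : u ∈ T.lowerBoundary c)
    (hvc : v ∈ T.lowerBoundary c) : u = v := by
  rcases suffix_total (mem_path.1 hu).1 (mem_path.1 hv).1 with h | h
  · exact BinTree.lowerBoundary_antichain hc huc hvc h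
  · exact (BinTree.lowerBoundary_antichain hc hvc huc h).symm

/-- Law of total expectation over the outcome of the search of a path. -/
theorem Inv.cutProb_mul_eq_sum (hs : Inv T s) {r x : Node} (hr : r ∈ s.forest)
    (hrx : r <:+ x) (hx : x ∈ T.leaves) {c : Finset Node} (hc : c ∈ T.cuts) (y : ℝ)
    (Y : Node → ℝ) (hY : ∀ u ∈ path x r, u ∈ T.lowerBoundary c → y = Y u) :
    T.cutProb s.p c * y =
      ∑ u ∈ (path x r).toFinset, edgeProb s.p u * (T.cutProb (posterior s.p u) c * Y u) := by
  have hz : ∀ v ∈ (path x r).toFinset, v ∉ T.lowerBoundary c →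
      edgeProb s.p v * (T.cutProb (posterior s.p v) c * Y v) = 0 := by
    intro v hv hvc
    have hvn := BinTree.mem_of_suffix (mem_path.1 (List.mem_toFinset.1 hv)).1
      (BinTree.mem_leaves.1 hx).1
    rw [BinTree.cutProb_posterior_of_not_mem hvn hvc]
    ring
  by_cases h : ∃ u ∈ path x r, u ∈ T.lowerBoundary c
  · obtain ⟨u, hu, huc⟩ := h
    rw [Finset.sum_eq_single_of_mem u (List.mem_toFinset.2 hu), hY u hu huc,
      BinTree.cutProb_eq_mul_posterior hc huc, mul_assoc]
    exact fun v hv hne => hz v hv fun hvc =>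
      hne (eq_of_mem_path hc (List.mem_toFinset.1 hv) hu hvc huc)
  · have h0 : T.cutProb s.p c = 0 := by
      by_contra h0
      exact h (hs.exists_mem_path hr hrx hx hc h0)
    rw [h0, zero_mul, Finset.sum_eq_zero]
    exact fun v hv => hz v hv fun hvc => h ⟨v, List.mem_toFinset.1 hv, hvc⟩

/-- Correctness and expected number of queries of the main loop, from any reachable state. -/
theorem Inv.exists_final (ch : Choices) (s : State) (hs : Inv T s) :
    ∃ final : Finset Node → State,
      (∀ c ∈ T.cuts, T.cutProb s.p c ≠ 0 →
        Run T ch (T.similarity c) s (final c) ∧ (final c).clusters = T.clustering c) ∧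
      ([] ∈ T.internal →
        ∑ c ∈ T.cuts, T.cutProb s.p c * ((final c).history.length : ℝ) ≤
          ∑ c ∈ T.cuts, T.cutProb s.p c *
            ((Real.logb 2 (T.height + 1) + 2) * (under (T.coreLeaves c) s.forest).card +
              s.history.length)) := by
  by_cases hF : s.forest = ∅
  · refine ⟨fun _ => s, fun c hc h0 => ⟨Run.done s hF, ?_⟩, fun _ => ?_⟩
    · ext C
      rw [hs.clusters c hc h0 C, hF]
      simp
    · rw [hF]
      simp [under]
  obtain ⟨r₀, hr₀⟩ := Finset.nonempty_iff_ne_empty.2 hF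
  obtain ⟨x₀, hx₀, hrx₀⟩ := BinTree.exists_leaf_below (hs.mem_nodes r₀ hr₀)
  have hepick : ch.path.pick s.history (T.maxEntropyPaths s.p s.forest) ∈
      T.maxEntropyPaths s.p s.forest := by
    refine ch.path.pick_mem _ _ (maximizers_nonempty ⟨(x₀, r₀), ?_⟩ _)
    simp [BinTree.forestPaths, hx₀, hr₀, hrx₀]
  obtain ⟨⟨x, r⟩, he⟩ : ∃ e, ch.path.pick s.history (T.maxEntropyPaths s.p s.forest) = e := ⟨_, rfl⟩
  rw [he] at hepick
  obtain ⟨⟨hx, hr, hrx⟩, -⟩ := mem_maxEntropyPaths.1 hepick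
  dsimp only at hx hr hrx
  have hxn := (BinTree.mem_leaves.1 hx).1
  have hpn : ∀ u ∈ path x r, u ∈ T.nodes := fun u hu =>
    BinTree.mem_of_suffix (mem_path.1 hu).1 hxn
  have hqpos : ∀ u ∈ path x r, 0 < edgeProb s.p u := fun u hu =>
    hs.edgeProb_pos hr (mem_path.1 hu).2 (hpn u hu)
  obtain ⟨R, hR, hRb⟩ := binarySearch_spec T ch (edgeProb s.p) (path x r) (path_ne_nil hrx)
    (path_pairwise x r) hpn hqpos s.history
  -- The root `r` leaves the forest whatever node is found, so the number of nodes in the forest is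
  -- a termination measure.
  have hlt : ∀ u ∈ path x r,
      (under T.nodes (nextState T s u r (R u)).forest).card < (under T.nodes s.forest).card :=
    fun u hu => hs.under_nextState_lt hr (mem_path.1 hu).2 (hs.mem_nodes r hr)
      (List.suffix_refl r) (mem_path.1 hu).2 (R u)
  -- Membership of `u` in the path is placed inside the existential, with a dummy value elsewhere,
  -- so that `choose` yields a function of `u` alone.
  have IH : ∀ u, ∃ final : Finset Node → State, u ∈ path x r →
      (∀ c ∈ T.cuts, T.cutProb (posterior s.p u) c ≠ 0 →
        Run T ch (T.similarity c) (nextState T s u r (R u)) (final c) ∧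
          (final c).clusters = T.clustering c) ∧
      ([] ∈ T.internal →
        ∑ c ∈ T.cuts, T.cutProb (posterior s.p u) c * ((final c).history.length : ℝ) ≤
          ∑ c ∈ T.cuts, T.cutProb (posterior s.p u) c *
            ((Real.logb 2 (T.height + 1) + 2) *
              (under (T.coreLeaves c) (nextState T s u r (R u)).forest).card + (R u).length)) := by
    intro u
    by_cases hu : u ∈ path x r
    · have := hlt u hu
      obtain ⟨f, hf⟩ := exists_final ch _ (hs.next hr (mem_path.1 hu).2 (hpn u hu) (R u))
      exact ⟨f, fun _ => hf⟩
    · exact ⟨fun _ => s, fun h => absurd h hu⟩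
  choose fin hfin using IH
  classical
  refine ⟨fun c => if h : ∃ u ∈ path x r, u ∈ T.lowerBoundary c then fin h.choose c else s,
    fun c hc h0 => ?_, fun hroot => ?_⟩
  · have h := hs.exists_mem_path hr hrx hx hc h0
    obtain ⟨hu, huc⟩ := h.choose_spec
    beta_reduce
    rw [dif_pos h]
    generalize h.choose = u at hu huc
    have h1 : T.cutProb (posterior s.p u) c ≠ 0 := by
      rw [BinTree.cutProb_eq_mul_posterior hc huc] at h0
      exact right_ne_zero_of_mul h0
    obtain ⟨hrun, hcl⟩ := (hfin u hu).1 c hc h1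
    refine ⟨Run.step s _ hF ?_, hcl⟩
    have hround : round T ch (T.similarity c) s = nextState T s u r (R u) := by
      unfold round
      simp only [he, hR u hu c hc huc]
      rfl
    rwa [hround]
  -- An internal root of `T` rules out trivial trees in the forest, so every round can be charged to
  -- a leaf of `T'_c`.
  · have hrint : r ∈ T.internal := BinTree.mem_internal.2 ⟨hs.mem_nodes r hr, fun h =>
      (BinTree.mem_internal.1 hroot).2 (hs.leaf_eq r hr h ▸ h)⟩
    have hnodup : (path x r).Nodup := (path_pairwise x r).imp fun h => h.2.symm
    have hsum := hs.sum_edgeProb hr hrx hx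
    have hlog : Real.logb 2 (path x r).length ≤ Real.logb 2 (T.height + 1) := by
      apply Real.logb_le_logb_of_le (by norm_num)
      · exact_mod_cast List.length_pos_iff.2 (path_ne_nil hrx)
      · exact_mod_cast (path_length_le x r).trans
          (Nat.add_le_add_right (Finset.le_sup (f := List.length) hxn) 1)
    have hB0 : 0 ≤ Real.logb 2 ((T.height : ℝ) + 1) :=
      Real.logb_nonneg (by norm_num) (by linarith [Nat.cast_nonneg (α := ℝ) T.height])
    set B := Real.logb 2 ((T.height : ℝ) + 1) + 2 with hB
    have hcost : ∑ u ∈ (path x r).toFinset, edgeProb s.p u * ((R u).length - s.history.length) ≤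
        B := by
      rw [List.sum_toFinset _ hnodup]
      have hend : ∀ j, j < (path x r).length → 0 < edgeProb s.p ((path x r).getD j []) := by
        intro j hj
        rw [List.getD_eq_getElem _ _ hj]
        exact hqpos _ (List.getElem_mem hj)
      have hl := List.length_pos_iff.2 (path_ne_nil hrx)
      rw [hsum] at hRb
      linarith [hend 0 hl, hend ((path x r).length - 1) (by omega)]
    have hone : ∀ u ∈ (path x r).toFinset, ∑ c ∈ T.cuts, T.cutProb (posterior s.p u) c = 1 :=
      fun u hu => BinTree.sum_cutProb (hs.prior.posterior (hpn u (List.mem_toFinset.1 hu))).leaf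
    have hsumF : ∑ u ∈ (path x r).toFinset, edgeProb s.p u = 1 := by
      rw [List.sum_toFinset _ hnodup, hsum]
    have hstep : ∀ u ∈ (path x r).toFinset,
        ∑ c ∈ T.cuts, T.cutProb (posterior s.p u) c * ((fin u c).history.length : ℝ) ≤
          ∑ c ∈ T.cuts, T.cutProb (posterior s.p u) c *
            (B * (under (T.coreLeaves c) s.forest).card + s.history.length) +
          ((R u).length - s.history.length) - B := by
      intro u hu
      have huP := List.mem_toFinset.1 hu
      have hru := (mem_path.1 huP).2
      calc _ ≤ ∑ c ∈ T.cuts, T.cutProb (posterior s.p u) c *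
            (B * (under (T.coreLeaves c) (nextState T s u r (R u)).forest).card +
              (R u).length) := (hfin u huP).2 hroot
        _ ≤ ∑ c ∈ T.cuts, (T.cutProb (posterior s.p u) c *
            (B * (under (T.coreLeaves c) s.forest).card + s.history.length) +
            T.cutProb (posterior s.p u) c * ((R u).length - s.history.length - B)) := by
          -- Cuts of zero posterior probability contribute nothing; for the others the forest loses
          -- a leaf of `T'_c`, which releases `B`.
          refine Finset.sum_le_sum fun c hc => ?_
          by_cases h0 : T.cutProb (posterior s.p u) c = 0
          · simp [h0]
          have huc := Inv.lowerBoundary_of_ne_zero (hpn u huP) h0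
          obtain ⟨i, hi, hri, hiu⟩ := exists_coreLeaf hc hrint hru huc (by
            rintro b a rfl hul
            have hux := BinTree.eq_of_leaf_suffix hul (mem_path.1 huP).1 hxn
            exact hs.sibling_leaf (hux ▸ hepick) hrint)
          have hK : ((under (T.coreLeaves c) (nextState T s u r (R u)).forest).card : ℝ) + 1 ≤
              (under (T.coreLeaves c) s.forest).card := by
            exact_mod_cast hs.under_nextState_lt hr hru hi hri hiu (R u)
          rw [← mul_add]
          refine mul_le_mul_of_nonneg_left ?_
            (BinTree.cutProb_nonneg (hs.prior.posterior (hpn u huP)) hc)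
          have := mul_le_mul_of_nonneg_left hK (by linarith : 0 ≤ B)
          linarith
        _ = _ := by
          rw [Finset.sum_add_distrib, ← Finset.sum_mul, hone u hu]
          ring
    calc _ = ∑ c ∈ T.cuts, ∑ u ∈ (path x r).toFinset,
          edgeProb s.p u * (T.cutProb (posterior s.p u) c * ((fin u c).history.length : ℝ)) := by
          refine Finset.sum_congr rfl fun c hc => hs.cutProb_mul_eq_sum hr hrx hx hc _
            (fun u => ((fin u c).history.length : ℝ)) fun u hu huc => ?_
          have h : ∃ u ∈ path x r, u ∈ T.lowerBoundary c := ⟨u, hu, huc⟩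
          beta_reduce
          rw [dif_pos h, eq_of_mem_path hc h.choose_spec.1 hu h.choose_spec.2 huc]
      _ = ∑ u ∈ (path x r).toFinset, edgeProb s.p u *
          ∑ c ∈ T.cuts, T.cutProb (posterior s.p u) c * ((fin u c).history.length : ℝ) := by
          rw [Finset.sum_comm]
          simp only [Finset.mul_sum]
      _ ≤ ∑ u ∈ (path x r).toFinset, (edgeProb s.p u *
            ∑ c ∈ T.cuts, T.cutProb (posterior s.p u) c *
              (B * (under (T.coreLeaves c) s.forest).card + s.history.length) +
            edgeProb s.p u * ((R u).length - s.history.length) - edgeProb s.p u * B) := by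
          refine Finset.sum_le_sum fun u hu => ?_
          rw [← mul_add, ← mul_sub]
          exact mul_le_mul_of_nonneg_left (hstep u hu) (hqpos u (List.mem_toFinset.1 hu)).le
      _ = ∑ c ∈ T.cuts, T.cutProb s.p c *
            (B * (under (T.coreLeaves c) s.forest).card + s.history.length) +
          ∑ u ∈ (path x r).toFinset, edgeProb s.p u * ((R u).length - s.history.length) - B := by
          rw [Finset.sum_sub_distrib, Finset.sum_add_distrib, ← Finset.sum_mul, hsumF, one_mul]
          congr 2
          simp only [Finset.mul_sum]
          rw [Finset.sum_comm]
          refine Finset.sum_congr rfl fun c hc => ?_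
          exact (hs.cutProb_mul_eq_sum hr hrx hx hc _ _ fun _ _ _ => rfl).symm
      -- By `hcost` the expected cost of the round is at most the released `B`.
      _ ≤ _ := by linarith
termination_by (under T.nodes s.forest).card

/-- The strict bounds `0 < p i < 1` at internal nodes come from the positivity of two particular
cuts. -/
theorem Inv.init {p : Node → ℝ} (hp : T.IsPrior p) (hpos : ∀ c ∈ T.cuts, 0 < T.cutProb p c) :
    Inv T (initState p) where
  prior := hp
  mem_nodes r hr := by
    rw [Finset.mem_singleton.1 hr]
    exact T.root_mem
  leaf_eq r hr _ := Finset.mem_singleton.1 hr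
  antichain r hr r' hr' _ := by
    rw [Finset.mem_singleton.1 hr, Finset.mem_singleton.1 hr']
  above r hr k hk hne := by
    rw [Finset.mem_singleton.1 hr] at hk hne
    exact absurd (List.suffix_nil.1 hk) hne
  inside i hi _ := by
    obtain ⟨hin, -⟩ := BinTree.mem_internal.1 hi
    constructor
    · refine (hp.nonneg i hin).lt_of_ne' fun h0 => ?_
      -- The cut with exactly the proper ancestors of `i` above it has `i` on its boundary, hence
      -- the factor `p i`.
      have hcut : i.tails.tail.toFinset ∈ T.cuts := by
        refine BinTree.mem_cuts.2 ⟨fun j hj => ?_, fun j hj => ?_⟩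
        · obtain ⟨h1, h2⟩ := mem_tails_tail.1 (List.mem_toFinset.1 hj)
          exact BinTree.internal_of_proper h1 h2 hin
        · obtain ⟨h1, h2⟩ := mem_tails_tail.1 (List.mem_toFinset.1 hj)
          refine List.mem_toFinset.2 (mem_tails_tail.2 ⟨(List.tail_suffix j).trans h1, ?_⟩)
          intro h
          exact h2 (suffix_antisymm h1 (h ▸ List.tail_suffix j))
      refine (hpos _ hcut).ne' (BinTree.cutProb_eq_zero_of_mem_lowerBoundary
        (BinTree.mem_lowerBoundary.2 ⟨hin, ?_, ?_⟩) h0)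
      · rw [List.mem_toFinset, mem_tails_tail]
        exact fun h => h.2 rfl
      · cases i with
        | nil => exact Or.inl rfl
        | cons b t =>
          refine Or.inr (List.mem_toFinset.2 (mem_tails_tail.2 ⟨List.suffix_cons b t, ?_⟩))
          simp
    · refine (hp.le_one i hin).lt_of_ne fun h1 => ?_
      -- The cut with all internal nodes above it has the factor `1 - p i`.
      have hcut : T.internal ∈ T.cuts := by
        refine BinTree.mem_cuts.2 ⟨Finset.Subset.refl _, fun j hj => ?_⟩
        by_cases h : j.tail = j
        · rwa [h]
        · exact BinTree.internal_of_proper (List.tail_suffix j) h (BinTree.mem_internal.1 hj).1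
      exact (hpos _ hcut).ne' (BinTree.cutProb_eq_zero_of_mem hi h1)
  clusters c _ _ C := by
    simp [initState, BinTree.clustering, eq_comm]

end WDP

end

/-! ### The constant -/

/-- There is a universal constant `C` such that, for every tree, every prior giving each cut
positive probability, and every way of making the choices the algorithm leaves open: on the
noiseless similarity matrix of each cut `c` the algorithm terminates and outputs the clustering of
`c`; and, for height `h ≥ 2`, its expected number of queries is at most `C * E[K̃(T, c)] * log h`. -/
theorem theoremt :
    ∃ C : ℝ, 0 < C ∧
      ∀ (T : WDP.BinTree) (p : WDP.Node → ℝ), T.IsPrior p →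
        (∀ c ∈ T.cuts, 0 < T.cutProb p c) →
        ∀ ch : WDP.Choices, ∃ final : Finset WDP.Node → WDP.State,
          (∀ c ∈ T.cuts,
            WDP.Run T ch (T.similarity c) (WDP.initState p) (final c) ∧
              (final c).clusters = T.clustering c) ∧
          (2 ≤ T.height →
            T.expect p (fun c => ((final c).history.length : ℝ)) ≤
              C * T.expect p (fun c => (T.kTilde c : ℝ)) * Real.logb 2 T.height) := by
  -- For `h ≥ 2`, `h + 1 ≤ h²` and `log₂ h ≥ 1` give `log₂ (h + 1) + 2 ≤ 4 log₂ h`.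
  refine ⟨4, by norm_num, fun T p hp hpos ch => ?_⟩
  obtain ⟨final, h1, h2⟩ := WDP.Inv.exists_final ch _ (WDP.Inv.init hp hpos)
  refine ⟨final, fun c hc => h1 c hc (hpos c hc).ne', fun hh => ?_⟩
  have hroot : [] ∈ T.internal := by
    refine WDP.BinTree.mem_internal.2 ⟨T.root_mem, fun hl => ?_⟩
    have h0 : T.height ≤ 0 := Finset.sup_le fun x hx => by
      rw [← WDP.BinTree.eq_of_leaf_suffix hl List.nil_suffix hx]
      rfl
    omega
  have h3 := h2 hroot
  have hexp : ∑ c ∈ T.cuts, T.cutProb (WDP.initState p).p c *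
      ((Real.logb 2 (T.height + 1) + 2) *
        (WDP.under (T.coreLeaves c) (WDP.initState p).forest).card +
          (WDP.initState p).history.length) =
      (Real.logb 2 (T.height + 1) + 2) * T.expect p (fun c => (T.kTilde c : ℝ)) := by
    rw [WDP.BinTree.expect, Finset.mul_sum]
    refine Finset.sum_congr rfl fun c _ => ?_
    have : WDP.under (T.coreLeaves c) (WDP.initState p).forest = T.coreLeaves c := by
      simp [WDP.under, WDP.initState]
    rw [this]
    simp only [WDP.initState, WDP.BinTree.coreLeaves, WDP.BinTree.kTilde, List.length_nil,
      Nat.cast_zero]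
    ring
  rw [hexp] at h3
  refine h3.trans ?_
  have hE : 0 ≤ T.expect p (fun c => (T.kTilde c : ℝ)) :=
    Finset.sum_nonneg fun c hc => mul_nonneg (hpos c hc).le (Nat.cast_nonneg _)
  have hh' : (2 : ℝ) ≤ T.height := by exact_mod_cast hh
  have hl1 : 1 ≤ Real.logb 2 T.height := by
    rw [← Real.logb_self_eq_one (b := 2) (by norm_num)]
    exact Real.logb_le_logb_of_le (by norm_num) (by norm_num) hh'
  have hl2 : Real.logb 2 (T.height + 1) ≤ 2 * Real.logb 2 T.height := by
    have e : 2 * Real.logb 2 T.height = Real.logb 2 ((T.height : ℝ) ^ 2) := by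
      rw [Real.logb_pow]
      norm_num
    rw [e]
    exact Real.logb_le_logb_of_le (by norm_num) (by linarith) (by nlinarith)
  nlinarith [mul_le_mul_of_nonneg_right
    (by linarith : Real.logb 2 (T.height + 1) + 2 ≤ 4 * Real.logb 2 T.height) hE]
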